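/- Notation. Let $\mathrm{Lip}(1)$ be the set of functions $h:\mathbb R\to\mathbb R$ with $|h(x)-h(y)|\le|x-y|$ for all $x,y$, and let $W_2$ be the set of differentiable $h:\mathbb R\to\mathbb R$ such that $h,h'\in\mathrm{Lip}(1)$. For real random variables $U,V$ put $$d_{W_2}(U,V)=\sup_{h\in W_2}|\mathbb E h(U)-\mathbb E h(V)|,\qquad d_K(U,V)=\sup_{a\in\mathbb R}|\mathbb P(U\le a)-\mathbb P(V\le a)|,$$ where the first supremum, with values in $[0,\infty]$, runs over those $h\in W_2$ for which both expectations exist (all $h \in W_2$ if $U$ and $V$ have finite mean). For $n\in\mathbb N$, $n\ge 1$, and $\lambda,\mu>0$ let $R=\lambda/\mu$. For $R<n$ let $X(\infty)$ have the stationary distribution of the customer count of the $M/M/n$ queue, i.e. of the continuous time Markov chain on $\{0,1,2,\dots\}$ that jumps from $k$ to $k+1$ at rate $\lambda$ and from $k$ to $k-1$ at rate $\mu\min(k,n)$. Let $\tilde X(\infty)=(X(\infty)-R)/\sqrt R$, $\zeta=(R-n)/\sqrt R$, $x^-=\max(-x,0)$, $$b(x)=\mu\big[(x+\zeta)^-+\zeta\big],\qquad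 a(x)=\mu\Big[1+1(x>-\sqrt R)\Big(1-\frac{(x+\zeta)^-+\zeta}{\sqrt R}\Big)\Big],$$ and let $Y(\infty)$ have the density $$\nu(x)=\frac{\kappa}{a(x)}\exp\Big(\int_0^x\frac{2b(y)}{a(y)}\,dy\Big),$$ where $\kappa>0$ is the normalization constant. Statement. (i) Let $U,V$ be real random variables such that $V$ has a density bounded by a constant $C>0$. If $d_{W_2}(U,V)<4C$, then $$d_K(U,V)\le 5\Big(\frac C2\Big)^{2/3}d_{W_2}(U,V)^{1/3}.$$ (ii) For all $n\ge1$ and $\lambda,\mu>0$ with $1\le R<n$, the function $\nu$ is a well-defined probability density and $0\le\nu(x)\le4$ for all $x\in\mathbb R$. (iii) There is a constant $K>0$, independent of $n,\lambda,\mu$, such that for all $n\ge1$ and $\lambda,\mu>0$ with $1\le R<n$, $$d_K\big(\tilde X(\infty),Y(\infty)\big)\le K\,R^{-1/3}.$$ -/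

import Mathlib

open MeasureTheory Set
open scoped ENNReal

namespace ErlangC

noncomputable section

/-! ### Probability metrics on the real line -/

/-- The distance between two laws on `ℝ` generated by a class `H` of test functions:
`sup_{h ∈ H} |E h(U) - E h(V)|`, with values in `[0, ∞]`.  The supremum runs over those `h ∈ H` for
which both expectations exist (all of `H` as soon as every `h ∈ H` is integrable under both laws). -/
def testDist (H : Set (ℝ → ℝ)) (ρ σ : Measure ℝ) : ℝ≥0∞ :=
  ⨆ (h : ℝ → ℝ) (_ : h ∈ H) (_ : Integrable h ρ) (_ : Integrable h σ),
    ENNReal.ofReal |(∫ x, h x ∂ρ) - ∫ x, h x ∂σ|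

/-- The class `W₂` of differentiable functions `h` such that `h` and `h'` are both in `Lip(1)`. -/
def W2 : Set (ℝ → ℝ) :=
  {h | Differentiable ℝ h ∧ LipschitzWith 1 h ∧ LipschitzWith 1 (deriv h)}

/-- The class of indicators of half-lines `(-∞, a]`. -/
def HK : Set (ℝ → ℝ) :=
  {h | ∃ a : ℝ, h = (Iic a).indicator (fun _ => (1 : ℝ))}

/-- The `W₂` distance between the laws of two real random variables. -/
def dW2 (ρ σ : Measure ℝ) : ℝ≥0∞ := testDist W2 ρ σ

/-- The Kolmogorov distance between the laws of two real random variables. -/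
def dK (ρ σ : Measure ℝ) : ℝ≥0∞ := testDist HK ρ σ

/-! ### The Erlang-C customer count process -/

/-- The generator matrix of the customer count in the `M/M/n` queue: arrivals at rate `lam`,
departures at rate `mu * min i n` when `i` customers are present. -/
def rate (lam mu : ℝ) (n : ℕ) (i j : ℕ) : ℝ :=
  if j = i + 1 then lam
  else if i = j + 1 then mu * (min i n : ℕ)
  else if i = j then -(lam + mu * (min i n : ℕ))
  else 0

/-- `p t i j`, for `t ≥ 0`, is the transition function of a continuous time Markov chain on `ℕ`
with generator matrix `q`. -/
structure IsTransitionFunction (q : ℕ → ℕ → ℝ) (p : ℝ → ℕ → ℕ → ℝ) : Prop where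
  nonneg : ∀ t, 0 ≤ t → ∀ i j, 0 ≤ p t i j
  row_sum : ∀ t, 0 ≤ t → ∀ i, HasSum (fun j => p t i j) 1
  zero : ∀ i j, p 0 i j = if i = j then 1 else 0
  chapman : ∀ s t, 0 ≤ s → 0 ≤ t → ∀ i k, HasSum (fun j => p s i j * p t j k) (p (s + t) i k)
  generator : ∀ i j, HasDerivWithinAt (fun t => p t i j) (q i j) (Ici 0) 0

/-- `ρ` is a stationary distribution of the Markov chain on `ℕ` with generator matrix `q`. -/
def IsStationary (q : ℕ → ℕ → ℝ) (ρ : Measure ℕ) : Prop :=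
  IsProbabilityMeasure ρ ∧
    ∃ p : ℝ → ℕ → ℕ → ℝ, IsTransitionFunction q p ∧
      ∀ t, 0 ≤ t → ∀ j, HasSum (fun i => ρ.real {i} * p t i j) (ρ.real {j})

/-- The offered load. -/
def load (lam mu : ℝ) : ℝ := lam / mu

/-- The normalization `k ↦ (k - R) / √R`. -/
def scaled (lam mu : ℝ) (k : ℕ) : ℝ := ((k : ℝ) - load lam mu) / √(load lam mu)

/-! ### The diffusion approximation -/

def zeta (lam mu : ℝ) (n : ℕ) : ℝ := (load lam mu - n) / √(load lam mu)

/-- The drift `b(x) = μ [(x + ζ)⁻ + ζ]`. -/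
def drift (lam mu : ℝ) (n : ℕ) (x : ℝ) : ℝ :=
  mu * (max (-(x + zeta lam mu n)) 0 + zeta lam mu n)

/-- The diffusion coefficient
`a(x) = μ [1 + 1(x > -√R) (1 - ((x + ζ)⁻ + ζ) / √R)]`. -/
def diffusion (lam mu : ℝ) (n : ℕ) (x : ℝ) : ℝ :=
  mu * (1 + (Ioi (-√(load lam mu))).indicator
    (fun y => 1 - (max (-(y + zeta lam mu n)) 0 + zeta lam mu n) / √(load lam mu)) x)

/-- The density of `Y(∞)` before normalization: `a(x)⁻¹ exp (∫₀ˣ 2 b(y) / a(y) dy)`. -/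
def preDensity (lam mu : ℝ) (n : ℕ) (x : ℝ) : ℝ :=
  1 / diffusion lam mu n x *
    Real.exp (∫ y in (0 : ℝ)..x, 2 * drift lam mu n y / diffusion lam mu n y)

/-- The normalization constant `κ`. -/
def kappa (lam mu : ℝ) (n : ℕ) : ℝ := (∫ x, preDensity lam mu n x)⁻¹

/-- The density `ν` of `Y(∞)`. -/
def nu (lam mu : ℝ) (n : ℕ) (x : ℝ) : ℝ := kappa lam mu n * preDensity lam mu n x

/-- The measure on `ℝ` with density `ν`, i.e. the law of `Y(∞)`. -/
def lawY (lam mu : ℝ) (n : ℕ) : Measure ℝ :=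
  volume.withDensity (fun x => ENNReal.ofReal (nu lam mu n x))

end

end ErlangC

namespace ErlangC

/-! ### Kolmogorov distance as a supremum over distribution functions -/

/-! (i) The indicator of a half-line is smoothed by a `ramp` climbing from 0 to ε²/4 over an
interval of length ε. Its derivative is a tent of slope 1 and height ε/2, so it lies in `W2` when ε
≤ 2. The ramps starting and ending at a lie on either side of ε²/4 times the indicator of (a, ∞).
Passing to the indicator costs nothing for the law of U and at most Cε³/8 for that of V, so the
distribution functions differ by at most Cε/2 + 4d/ε². Taking ε³ = 2d/C gives 5 (C/2)^(2/3) d^(1/3),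
and d < 4C ensures ε ≤ 2.

(ii) With r = √R and z = -ζ the density is explicit up to a constant: Gaussian left of -r, a shifted
gamma density (1 + x/(2r))^(4r² - 1) exp(-2rx) on [-r, z], exponential beyond z. Scaled to be 1 at
the origin, it is at most exp(1/2) ≤ 5/3 and has mass at least 1/2 on [-1, 0], so the normalised
density is at most 10/3.

(iii) Part (i) plays no role: both laws are explicit and are compared directly, with error
O(R^(-1/2)), which is stronger than required. Detailed balance makes the stationary weights Poisson
up to n and geometric afterwards. In the centre, the logarithms of the Poisson weight and of the
density both equal -x²/2 up to O((1 + |x|)³/r), and both are at most 2 - |x|/2 throughout the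
relevant range. Hence lattice sums of mesh 1/r follow the integrals within O(1/r), uniformly in the
upper limit (`abs_exp_logWeight_sub_dens_le`). Beyond n, a geometric sum is set against an
exponential integral (`geom_sub_exp_le`). When n is close to R this tail has unbounded mass, so
errors are measured relative to the total mass V of the unnormalised density; such a bound survives
normalisation (`abs_mul_sum_sub_le`). -/

theorem dK_le {ρ σ : Measure ℝ} {D : ℝ≥0∞}
    (h : ∀ a : ℝ, ENNReal.ofReal |ρ.real (Iic a) - σ.real (Iic a)| ≤ D) : dK ρ σ ≤ D := by
  unfold dK testDist
  refine iSup_le fun f => iSup_le fun hf => iSup_le fun _ => iSup_le fun _ => ?_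
  obtain ⟨a, rfl⟩ := hf
  simpa [integral_indicator_const, measurableSet_Iic] using h a

/-! ### The smoothed indicator -/

/-- A tent of slope `1` supported on `[a, a + ε]`. -/
noncomputable def tent (a ε t : ℝ) : ℝ := max 0 (ε / 2 - |t - (a + ε / 2)|)

/-- The primitive of the tent vanishing at `a`. -/
noncomputable def ramp (a ε x : ℝ) : ℝ := ∫ t in a..x, tent a ε t

theorem continuous_tent (a ε : ℝ) : Continuous (tent a ε) := by
  unfold tent; fun_prop

theorem tent_nonneg (a ε t : ℝ) : 0 ≤ tent a ε t := le_max_left _ _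

theorem tent_le (a : ℝ) {ε : ℝ} (hε : 0 ≤ ε) (t : ℝ) : tent a ε t ≤ ε / 2 :=
  max_le (by linarith) (by linarith [abs_nonneg (t - (a + ε / 2))])

theorem hasDerivAt_ramp (a ε x : ℝ) : HasDerivAt (ramp a ε) (tent a ε x) x :=
  intervalIntegral.integral_hasDerivAt_right ((continuous_tent a ε).intervalIntegrable _ _)
    (continuous_tent a ε).stronglyMeasurable.stronglyMeasurableAtFilter
    (continuous_tent a ε).continuousAt

theorem lipschitzWith_tent (a ε : ℝ) : LipschitzWith 1 (tent a ε) := by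
  refine LipschitzWith.of_dist_le_mul fun x y => ?_
  simp only [NNReal.coe_one, one_mul, Real.dist_eq, tent]
  rw [max_comm 0, max_comm 0]
  refine (abs_max_sub_max_le_abs _ _ _).trans ?_
  have := abs_abs_sub_abs_le_abs_sub (y - (a + ε / 2)) (x - (a + ε / 2))
  rw [show ε / 2 - |x - (a + ε / 2)| - (ε / 2 - |y - (a + ε / 2)|)
    = |y - (a + ε / 2)| - |x - (a + ε / 2)| by ring]
  refine this.trans (le_of_eq ?_)
  rw [abs_sub_comm]; congr 1; ring

/-- The tent has height ε/2, so ε ≤ 2 is what makes the ramp itself 1-Lipschitz; the tent is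
1-Lipschitz for every ε. -/
theorem ramp_mem_W2 (a : ℝ) {ε : ℝ} (h0 : 0 ≤ ε) (h2 : ε ≤ 2) : ramp a ε ∈ W2 := by
  have hd : deriv (ramp a ε) = tent a ε := funext fun x => (hasDerivAt_ramp a ε x).deriv
  refine ⟨fun x => (hasDerivAt_ramp a ε x).differentiableAt, ?_, hd ▸ lipschitzWith_tent a ε⟩
  refine lipschitzWith_of_nnnorm_deriv_le
    (fun x => (hasDerivAt_ramp a ε x).differentiableAt) fun x => ?_
  rw [hd, ← NNReal.coe_le_coe, coe_nnnorm, Real.norm_eq_abs, abs_of_nonneg (tent_nonneg _ _ _)]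
  have := tent_le a h0 x
  simp only [NNReal.coe_one]; linarith

theorem monotone_ramp (a ε : ℝ) : Monotone (ramp a ε) := by
  refine monotone_of_deriv_nonneg (fun x => (hasDerivAt_ramp a ε x).differentiableAt) fun x => ?_
  rw [(hasDerivAt_ramp a ε x).deriv]; exact tent_nonneg _ _ _

theorem continuous_ramp (a ε : ℝ) : Continuous (ramp a ε) :=
  continuous_iff_continuousAt.2 fun x => (hasDerivAt_ramp a ε x).continuousAt

theorem tent_eq_zero_of_le {a ε t : ℝ} (h : t ≤ a) : tent a ε t = 0 := by
  refine max_eq_left ?_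
  have := neg_abs_le (t - (a + ε / 2)); linarith

theorem tent_eq_zero_of_ge {a ε t : ℝ} (h : a + ε ≤ t) : tent a ε t = 0 := by
  refine max_eq_left ?_
  have := le_abs_self (t - (a + ε / 2)); linarith

theorem ramp_eq_zero {a ε x : ℝ} (h : x ≤ a) : ramp a ε x = 0 := by
  unfold ramp
  rw [intervalIntegral.integral_congr (g := fun _ => 0), intervalIntegral.integral_zero]
  intro t ht
  rw [uIcc_of_ge h] at ht
  exact tent_eq_zero_of_le ht.2

theorem ramp_end (a : ℝ) {ε : ℝ} (hε : 0 ≤ ε) : ramp a ε (a + ε) = ε ^ 2 / 4 := by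
  have hc := continuous_tent a ε
  unfold ramp
  rw [← intervalIntegral.integral_add_adjacent_intervals (b := a + ε / 2)
    (hc.intervalIntegrable _ _) (hc.intervalIntegrable _ _)]
  have h1 : ∫ t in a..a + ε / 2, tent a ε t = ∫ t in a..a + ε / 2, (t - a) := by
    refine intervalIntegral.integral_congr fun t ht => ?_
    rw [uIcc_of_le (by linarith)] at ht
    simp only [tent]
    rw [abs_of_nonpos (by linarith [ht.2]), max_eq_right (by linarith [ht.1])]; ring
  have h2 : ∫ t in a + ε / 2..a + ε, tent a ε t = ∫ t in a + ε / 2..a + ε, (a + ε - t) := by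
    refine intervalIntegral.integral_congr fun t ht => ?_
    rw [uIcc_of_le (by linarith)] at ht
    simp only [tent]
    rw [abs_of_nonneg (by linarith [ht.1]), max_eq_right (by linarith [ht.2])]; ring
  have hI : ∀ (g : ℝ → ℝ) (u v : ℝ), Continuous g → IntervalIntegrable g volume u v :=
    fun g u v hg => hg.intervalIntegrable u v
  rw [h1, h2, intervalIntegral.integral_sub (hI _ _ _ (by fun_prop)) (hI _ _ _ (by fun_prop)),
    intervalIntegral.integral_sub (hI _ _ _ (by fun_prop)) (hI _ _ _ (by fun_prop))]
  simp only [integral_id, intervalIntegral.integral_const, smul_eq_mul]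
  ring

theorem ramp_of_ge {a ε x : ℝ} (hε : 0 ≤ ε) (h : a + ε ≤ x) : ramp a ε x = ε ^ 2 / 4 := by
  have hc := continuous_tent a ε
  rw [← ramp_end a hε]
  unfold ramp
  rw [← intervalIntegral.integral_add_adjacent_intervals (b := a + ε) (c := x)
    (hc.intervalIntegrable _ _) (hc.intervalIntegrable _ _), add_eq_left,
    intervalIntegral.integral_congr (g := fun _ => 0), intervalIntegral.integral_zero]
  intro t ht
  rw [uIcc_of_le h] at ht
  exact tent_eq_zero_of_ge ht.1

theorem ramp_nonneg {a ε : ℝ} (x : ℝ) : 0 ≤ ramp a ε x := by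
  rcases le_total x a with h | h
  · exact (ramp_eq_zero h).ge
  · exact (ramp_eq_zero le_rfl).ge.trans (monotone_ramp a ε h)

theorem ramp_le {a ε : ℝ} (hε : 0 ≤ ε) (x : ℝ) : ramp a ε x ≤ ε ^ 2 / 4 := by
  rcases le_total x (a + ε) with h | h
  · exact (monotone_ramp a ε h).trans (ramp_end a hε).le
  · exact (ramp_of_ge hε h).le

/-- The tent is symmetric about a + ε/2. Hence the ramp averages half its maximum over [a, a + ε],
and both the ramp and its complement integrate to ε³/8 there. -/
theorem ramp_add_ramp_reflect (a : ℝ) {ε : ℝ} (hε : 0 ≤ ε) (x : ℝ) :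
    ramp a ε x + ramp a ε (2 * a + ε - x) = ε ^ 2 / 4 := by
  have hc := continuous_tent a ε
  have h : ramp a ε (2 * a + ε - x) = ∫ t in x..a + ε, tent a ε t := by
    have := intervalIntegral.integral_comp_sub_left (a := x) (b := a + ε) (tent a ε) (2 * a + ε)
    rw [show 2 * a + ε - (a + ε) = a by ring] at this
    rw [ramp, ← this]
    refine intervalIntegral.integral_congr fun t _ => ?_
    simp only [tent]
    rw [← abs_neg]; congr 3; ring
  rw [h, ramp, intervalIntegral.integral_add_adjacent_intervals (hc.intervalIntegrable _ _)
    (hc.intervalIntegrable _ _), ← ramp_end a hε, ramp]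

theorem integral_ramp (a : ℝ) {ε : ℝ} (hε : 0 ≤ ε) :
    ∫ x in a..a + ε, ramp a ε x = ε ^ 3 / 8 := by
  have hc := continuous_ramp a ε
  have h1 := intervalIntegral.integral_comp_sub_left (a := a) (b := a + ε) (ramp a ε) (2 * a + ε)
  rw [show 2 * a + ε - (a + ε) = a by ring, show 2 * a + ε - a = a + ε by ring] at h1
  have h2 : ∫ x in a..a + ε, (ramp a ε x + ramp a ε (2 * a + ε - x))
      = ∫ _ in a..a + ε, ε ^ 2 / 4 :=
    intervalIntegral.integral_congr fun x _ => ramp_add_ramp_reflect a hε x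
  rw [intervalIntegral.integral_add (hc.intervalIntegrable _ _)
    (Continuous.intervalIntegrable (by fun_prop) _ _),
    intervalIntegral.integral_const, h1, smul_eq_mul] at h2
  linarith

/-! ### The smoothing inequality -/

theorem integrable_ramp (a : ℝ) {ε : ℝ} (hε : 0 ≤ ε) (ρ : Measure ℝ) [IsFiniteMeasure ρ] :
    Integrable (ramp a ε) ρ :=
  Integrable.of_bound (continuous_ramp a ε).aestronglyMeasurable (ε ^ 2 / 4)
    (Filter.Eventually.of_forall fun x => by
      rw [Real.norm_eq_abs, abs_of_nonneg (ramp_nonneg x)]; exact ramp_le hε x)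

theorem abs_integral_ramp_sub_le {ρ σ : Measure ℝ} [IsFiniteMeasure ρ] [IsFiniteMeasure σ]
    (hd : dW2 ρ σ ≠ ∞) (a : ℝ) {ε : ℝ} (h0 : 0 ≤ ε) (h2 : ε ≤ 2) :
    |(∫ x, ramp a ε x ∂ρ) - ∫ x, ramp a ε x ∂σ| ≤ (dW2 ρ σ).toReal := by
  have h : ENNReal.ofReal |(∫ x, ramp a ε x ∂ρ) - ∫ x, ramp a ε x ∂σ| ≤ dW2 ρ σ := by
    unfold dW2 testDist
    exact le_iSup_of_le (ramp a ε) (le_iSup_of_le (ramp_mem_W2 a h0 h2)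
      (le_iSup_of_le (integrable_ramp a h0 ρ) (le_iSup_of_le (integrable_ramp a h0 σ) le_rfl)))
  exact (ENNReal.ofReal_le_iff_le_toReal hd).1 h

/-- If `g` vanishes off `(a, a + ε]`, its integral under a law with density at most `C` is
at most `C` times its Lebesgue integral. -/
theorem integral_le_of_le_smul_volume {σ : Measure ℝ} {C : ℝ} (hC : 0 ≤ C)
    (hσ : σ ≤ ENNReal.ofReal C • (volume : Measure ℝ)) {a ε : ℝ} (hε : 0 ≤ ε) {g : ℝ → ℝ}
    (hg : Continuous g) (hg0 : ∀ x, 0 ≤ g x) :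
    ∫ x in Ioc a (a + ε), g x ∂σ ≤ C * ∫ x in a..a + ε, g x := by
  have hi : IntegrableOn g (Ioc a (a + ε)) volume :=
    (hg.integrableOn_Icc).mono_set Ioc_subset_Icc_self
  have hr : σ.restrict (Ioc a (a + ε))
      ≤ ENNReal.ofReal C • (volume : Measure ℝ).restrict (Ioc a (a + ε)) := by
    rw [← Measure.restrict_smul]
    exact Measure.restrict_mono le_rfl hσ
  refine (integral_mono_measure hr (Filter.Eventually.of_forall hg0)
    (hi.smul_measure ENNReal.ofReal_ne_top)).trans (le_of_eq ?_)
  rw [integral_smul_measure, ENNReal.toReal_ofReal hC, smul_eq_mul,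
    intervalIntegral.integral_of_le (by linarith)]

theorem abs_cdf_sub_le_of_ramp {ρ σ : Measure ℝ} [IsProbabilityMeasure ρ] [IsProbabilityMeasure σ]
    {C : ℝ} (hC : 0 ≤ C) (hσ : σ ≤ ENNReal.ofReal C • (volume : Measure ℝ))
    (hd : dW2 ρ σ ≠ ∞) {ε : ℝ} (h0 : 0 < ε) (h2 : ε ≤ 2) (a : ℝ) :
    |ρ.real (Iic a) - σ.real (Iic a)| ≤ C * ε / 2 + 4 * (dW2 ρ σ).toReal / ε ^ 2 := by
  set d := (dW2 ρ σ).toReal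
  set c := ε ^ 2 / 4 with hc
  have hcpos : 0 < c := by positivity
  -- integrals of the ramp against the two laws
  have hsplit : ∀ (τ : Measure ℝ) [IsProbabilityMeasure τ] (b : ℝ),
      ∫ x, ramp b ε x ∂τ = (∫ x in Ioc b (b + ε), ramp b ε x ∂τ) + c * τ.real (Ioi (b + ε)) := by
    intro τ _ b
    have hi := integrable_ramp b h0.le τ
    rw [← integral_add_compl (measurableSet_Iic (a := b)) hi,
      setIntegral_congr_fun (g := fun _ => (0 : ℝ)) measurableSet_Iic
        (fun x hx => ramp_eq_zero hx), integral_zero, zero_add, compl_Iic,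
      ← Ioc_union_Ioi_eq_Ioi (by linarith : b ≤ b + ε),
      setIntegral_union (Ioc_disjoint_Ioi le_rfl) measurableSet_Ioi hi.integrableOn
        hi.integrableOn,
      setIntegral_congr_fun (s := Ioi (b + ε)) (g := fun _ => c) measurableSet_Ioi
        (fun x hx => ramp_of_ge h0.le (le_of_lt hx)), setIntegral_const, smul_eq_mul, mul_comm]
  have hmass : ∀ (τ : Measure ℝ) [IsProbabilityMeasure τ] (b : ℝ),
      τ.real (Ioi b) = τ.real (Ioc b (b + ε)) + τ.real (Ioi (b + ε)) := by
    intro τ _ b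
    rw [← measureReal_union (Ioc_disjoint_Ioi le_rfl) measurableSet_Ioi,
      Ioc_union_Ioi_eq_Ioi (by linarith)]
  have hlow : ∀ (τ : Measure ℝ) [IsProbabilityMeasure τ] (b : ℝ),
      0 ≤ ∫ x in Ioc b (b + ε), ramp b ε x ∂τ :=
    fun τ _ b => integral_nonneg fun x => ramp_nonneg x
  have hupp : ∀ (τ : Measure ℝ) [IsProbabilityMeasure τ] (b : ℝ),
      ∫ x in Ioc b (b + ε), ramp b ε x ∂τ ≤ c * τ.real (Ioc b (b + ε)) := by
    intro τ _ b
    have := setIntegral_mono (integrable_ramp b h0.le τ).integrableOn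
      (integrable_const c).integrableOn (fun x => ramp_le h0.le x) (μ := τ) (s := Ioc b (b + ε))
    rwa [setIntegral_const, smul_eq_mul, mul_comm] at this
  have hV1 : ∀ b, ∫ x in Ioc b (b + ε), ramp b ε x ∂σ ≤ C * (ε ^ 3 / 8) := fun b => by
    have := integral_le_of_le_smul_volume hC hσ h0.le (a := b) (continuous_ramp b ε)
      (fun x => ramp_nonneg x)
    rwa [integral_ramp b h0.le] at this
  have hV2 : ∀ b, c * σ.real (Ioc b (b + ε)) - ∫ x in Ioc b (b + ε), ramp b ε x ∂σ
      ≤ C * (ε ^ 3 / 8) := fun b => by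
    have h := integral_le_of_le_smul_volume hC hσ h0.le (a := b)
      (g := fun x => c - ramp b ε x) (continuous_const.sub (continuous_ramp b ε))
      (fun x => sub_nonneg.2 (ramp_le h0.le x))
    rw [intervalIntegral.integral_sub (continuous_const.intervalIntegrable _ _)
      ((continuous_ramp b ε).intervalIntegrable _ _),
      integral_ramp b h0.le, integral_sub (integrable_const c)
        (integrable_ramp b h0.le σ).integrableOn, setIntegral_const,
      intervalIntegral.integral_const, smul_eq_mul, smul_eq_mul] at h
    have e : (b + ε - b) * c - ε ^ 3 / 8 = ε ^ 3 / 8 := by rw [hc]; ring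
    rw [e] at h; linarith
  have hcompl : ∀ (τ : Measure ℝ) [IsProbabilityMeasure τ],
      τ.real (Iic a) = 1 - τ.real (Ioi a) := by
    intro τ _
    rw [← compl_Iic, measureReal_compl measurableSet_Iic]; simp
  have key : c * |ρ.real (Iic a) - σ.real (Iic a)| ≤ C * (ε ^ 3 / 8) + d := by
    -- The ramp ending at a bounds ρ(a, ∞) from above, the one starting at a bounds it from below.
    -- The transition interval matters only under σ, where the density bound controls it.
    have e := abs_le.1 (abs_integral_ramp_sub_le hd (a - ε) h0.le h2)
    have e' := abs_le.1 (abs_integral_ramp_sub_le hd a h0.le h2)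
    rw [hsplit ρ, hsplit σ] at e e'
    have e1 := hV1 (a - ε)
    have e2 := hlow ρ (a - ε)
    rw [sub_add_cancel] at e e1 e2
    have e3 := hV2 a
    have e4 := hupp ρ a
    have m1 := congrArg (c * ·) (hmass ρ a)
    have m2 := congrArg (c * ·) (hmass σ a)
    simp only [mul_add] at m1 m2
    rw [hcompl ρ, hcompl σ]
    nth_rewrite 1 [← abs_of_pos hcpos]
    rw [← abs_mul, abs_le, show c * (1 - ρ.real (Ioi a) - (1 - σ.real (Ioi a)))
      = c * σ.real (Ioi a) - c * ρ.real (Ioi a) by ring]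
    constructor <;> linarith [e.1, e.2, e'.1, e'.2]
  have : |ρ.real (Iic a) - σ.real (Iic a)| ≤ (C * (ε ^ 3 / 8) + d) / c := by
    rw [le_div_iff₀ hcpos]; linarith
  refine this.trans (le_of_eq ?_)
  rw [hc]; field_simp; ring

theorem dK_le_of_le_smul_volume {ρ σ : Measure ℝ} [IsProbabilityMeasure ρ]
    [IsProbabilityMeasure σ] {C : ℝ} (hC : 0 < C)
    (hσ : σ ≤ ENNReal.ofReal C • (volume : Measure ℝ))
    (hd : dW2 ρ σ < ENNReal.ofReal (4 * C)) :
    dK ρ σ ≤ ENNReal.ofReal (5 * (C / 2) ^ (2 / 3 : ℝ)) * dW2 ρ σ ^ (1 / 3 : ℝ) := by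
  have hfin : dW2 ρ σ ≠ ∞ := hd.ne_top
  set d := (dW2 ρ σ).toReal with hd'
  have hd0 : 0 ≤ d := ENNReal.toReal_nonneg
  have hdC : d < 4 * C := by
    rw [← ENNReal.toReal_ofReal (by positivity : (0 : ℝ) ≤ 4 * C)]
    exact ENNReal.toReal_strict_mono ENNReal.ofReal_ne_top hd
  rw [← ENNReal.ofReal_toReal hfin, ← hd', ENNReal.ofReal_rpow_of_nonneg hd0 (by norm_num),
    ← ENNReal.ofReal_mul (by positivity)]
  refine dK_le fun a => ENNReal.ofReal_le_ofReal ?_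
  rcases hd0.eq_or_lt with h | h
  · rw [← h, Real.zero_rpow (by norm_num), mul_zero]
    refine le_of_forall_pos_le_add fun δ hδ => ?_
    -- For d = 0 the choice ε³ = 2d/C degenerates, so ε is made arbitrarily small instead.
    have hε : 0 < min 2 (δ / C) := lt_min (by norm_num) (by positivity)
    have := abs_cdf_sub_le_of_ramp hC.le hσ hfin hε (min_le_left _ _) a
    rw [← hd', ← h, mul_zero, zero_div, add_zero] at this
    have h3 : C * min 2 (δ / C) ≤ δ := by
      calc C * min 2 (δ / C) ≤ C * (δ / C) := by gcongr; exact min_le_right _ _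
        _ = δ := by field_simp
    linarith
  · -- the choice `ε ^ 3 = 2 d / C`
    set u := (C / 2) ^ (1 / 3 : ℝ) with hu
    set v := d ^ (1 / 3 : ℝ) with hv
    have hu0 : 0 < u := by positivity
    have hv0 : 0 < v := by positivity
    have hu3 : u ^ 3 = C / 2 := by
      rw [hu, ← Real.rpow_natCast, ← Real.rpow_mul (by positivity)]; norm_num
    have hv3 : v ^ 3 = d := by
      rw [hv, ← Real.rpow_natCast, ← Real.rpow_mul (by positivity)]; norm_num
    have hu2 : (C / 2) ^ (2 / 3 : ℝ) = u ^ 2 := by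
      rw [hu, ← Real.rpow_natCast, ← Real.rpow_mul (by positivity)]; norm_num
    -- Cubing turns this into 2d/C ≤ 8, which is where d < 4C enters.
    have hε2 : v / u ≤ 2 := by
      rw [div_le_iff₀ hu0]
      refine le_of_pow_le_pow_left₀ (n := 3) (by norm_num) (by positivity) ?_
      rw [hv3, mul_pow, hu3]; linarith
    have := abs_cdf_sub_le_of_ramp hC.le hσ hfin (div_pos hv0 hu0) hε2 a
    rw [← hd', ← hv3, show C = 2 * u ^ 3 by linarith] at this
    rw [hu2]
    refine this.trans (le_of_eq ?_)
    field_simp; ring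

theorem map_le_smul_volume {Ω : Type*} [MeasurableSpace Ω] {P : Measure Ω} {V : Ω → ℝ} {C : ℝ}
    [HasPDF V P volume] (h : ∀ᵐ x ∂volume, pdf V P volume x ≤ ENNReal.ofReal C) :
    P.map V ≤ ENNReal.ofReal C • (volume : Measure ℝ) := by
  rw [map_eq_withDensity_pdf V P volume, ← withDensity_const]
  exact withDensity_mono h

/-! ### The unnormalised stationary density in scaled form

Throughout, `r = √R` and `z = -ζ`. -/

/-- The diffusion coefficient divided by `μ`. -/
noncomputable def scaledDiffusion (r z x : ℝ) : ℝ := 1 + max 0 (1 + min x z / r)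

/-- The ratio `2 b / a`. -/
noncomputable def logSlope (r z x : ℝ) : ℝ := -2 * min x z / scaledDiffusion r z x

/-- The stationary density, normalised to take the value `1` at the origin. -/
noncomputable def dens (r z x : ℝ) : ℝ :=
  2 / scaledDiffusion r z x * Real.exp (∫ y in (0 : ℝ)..x, logSlope r z y)

theorem drift_eq (lam mu : ℝ) (n : ℕ) (x : ℝ) :
    drift lam mu n x = mu * -min x (-zeta lam mu n) := by
  unfold drift
  rw [← max_neg_neg, neg_neg, ← max_add_add_right]
  congr 2 <;> ring

/-- The factor behind the indicator is 1 + min(x, z)/r, which changes sign exactly at x = -r because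
z ≥ 0. The cut-off is therefore a positive part, and the coefficient is continuous. -/
theorem diffusion_eq {lam mu : ℝ} {n : ℕ} (hR : 0 < load lam mu) (hz : zeta lam mu n ≤ 0)
    (x : ℝ) :
    diffusion lam mu n x = mu * scaledDiffusion (√(load lam mu)) (-zeta lam mu n) x := by
  have hr : 0 < √(load lam mu) := Real.sqrt_pos.2 hR
  have hd : max (-(x + zeta lam mu n)) 0 + zeta lam mu n = -min x (-zeta lam mu n) := by
    rw [← max_neg_neg, neg_neg, ← max_add_add_right]
    congr 1 <;> ring
  unfold diffusion scaledDiffusion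
  congr 2
  by_cases h : -√(load lam mu) < x
  · rw [indicator_of_mem (show x ∈ Ioi (-√(load lam mu)) from h), hd, max_eq_right]
    · ring
    · have : -√(load lam mu) ≤ min x (-zeta lam mu n) := le_min h.le (by linarith)
      rw [← neg_le_iff_add_nonneg', le_div_iff₀ hr]; linarith
  · rw [indicator_of_notMem (show x ∉ Ioi (-√(load lam mu)) from h), max_eq_left]
    have h' : min x (-zeta lam mu n) ≤ -√(load lam mu) := (min_le_left _ _).trans (not_lt.1 h)
    have : min x (-zeta lam mu n) / √(load lam mu) ≤ -1 := by
      rw [div_le_iff₀ hr]; linarith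
    linarith

theorem preDensity_eq {lam mu : ℝ} {n : ℕ} (hmu : 0 < mu) (hR : 0 < load lam mu)
    (hz : zeta lam mu n ≤ 0) (x : ℝ) :
    preDensity lam mu n x = (2 * mu)⁻¹ * dens (√(load lam mu)) (-zeta lam mu n) x := by
  unfold preDensity dens
  have h : ∀ y, 2 * drift lam mu n y / diffusion lam mu n y
      = logSlope (√(load lam mu)) (-zeta lam mu n) y := by
    intro y
    rw [drift_eq, diffusion_eq hR hz, logSlope,
      show 2 * (mu * -min y (-zeta lam mu n)) = mu * (-2 * min y (-zeta lam mu n)) by ring,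
      mul_div_mul_left _ _ hmu.ne']
  simp_rw [h]
  rw [diffusion_eq hR hz]
  field_simp

theorem nu_eq {lam mu : ℝ} {n : ℕ} (hmu : 0 < mu) (hR : 0 < load lam mu)
    (hz : zeta lam mu n ≤ 0) (x : ℝ) :
    nu lam mu n x = (∫ y, dens (√(load lam mu)) (-zeta lam mu n) y)⁻¹ *
      dens (√(load lam mu)) (-zeta lam mu n) x := by
  unfold nu kappa
  simp_rw [preDensity_eq hmu hR hz]
  rw [integral_const_mul]
  field_simp

section dens

variable {r z : ℝ}

theorem scaledDiffusion_pos (r z x : ℝ) : 0 < scaledDiffusion r z x :=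
  add_pos_of_pos_of_nonneg one_pos (le_max_left _ _)

theorem continuous_scaledDiffusion (r z : ℝ) : Continuous (scaledDiffusion r z) := by
  unfold scaledDiffusion; fun_prop

theorem continuous_logSlope (r z : ℝ) : Continuous (logSlope r z) := by
  unfold logSlope
  exact Continuous.div (by fun_prop) (continuous_scaledDiffusion r z)
    fun x => (scaledDiffusion_pos r z x).ne'

theorem dens_pos (r z x : ℝ) : 0 < dens r z x :=
  mul_pos (div_pos two_pos (scaledDiffusion_pos r z x)) (Real.exp_pos _)

theorem continuous_dens (r z : ℝ) : Continuous (dens r z) := by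
  unfold dens
  refine (continuous_const.div (continuous_scaledDiffusion r z)
    fun x => (scaledDiffusion_pos r z x).ne').mul (Real.continuous_exp.comp ?_)
  exact intervalIntegral.continuous_primitive
    (fun a b => (continuous_logSlope r z).intervalIntegrable a b) 0

theorem scaledDiffusion_mid (hr : 0 < r) {x : ℝ} (h1 : -r ≤ x) (h2 : x ≤ z) :
    scaledDiffusion r z x = 2 * (1 + x / (2 * r)) := by
  have : -1 ≤ x / r := by rw [le_div_iff₀ hr]; linarith
  rw [scaledDiffusion, min_eq_left h2, max_eq_right (by linarith)]
  field_simp; ring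

theorem one_add_div_pos (hr : 0 < r) {x : ℝ} (h1 : -r ≤ x) : 1 / 2 ≤ 1 + x / (2 * r) := by
  have : -1 / 2 ≤ x / (2 * r) := by rw [le_div_iff₀ (by positivity)]; linarith
  linarith

/-- With w = 1 + x/(2r), the slope 2b/a is -x/w and integrates to 4r² log w - 2rx. The prefactor 1/w
lowers the coefficient 4r² by 1. -/
theorem dens_mid (hr : 0 < r) (hz : 0 ≤ z) {x : ℝ} (h1 : -r ≤ x) (h2 : x ≤ z) :
    dens r z x = Real.exp ((4 * r ^ 2 - 1) * Real.log (1 + x / (2 * r)) - 2 * r * x) := by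
  have hsub : ∀ y ∈ uIcc 0 x, -r ≤ y ∧ y ≤ z := by
    intro y hy
    have := uIcc_subset_Icc (a₁ := (0 : ℝ)) (b₁ := x) (a₂ := -r) (b₂ := z)
      ⟨by linarith, hz⟩ ⟨h1, h2⟩ hy
    exact this
  have hint : ∫ y in (0 : ℝ)..x, logSlope r z y
      = 4 * r ^ 2 * Real.log (1 + x / (2 * r)) - 2 * r * x := by
    rw [intervalIntegral.integral_eq_sub_of_hasDerivAt
      (f := fun y => 4 * r ^ 2 * Real.log (1 + y / (2 * r)) - 2 * r * y) ?_
      ((continuous_logSlope r z).intervalIntegrable _ _)]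
    · simp
    · intro y hy
      obtain ⟨hy1, hy2⟩ := hsub y hy
      have hp : 0 < 1 + y / (2 * r) := by linarith [one_add_div_pos hr hy1]
      have hd : HasDerivAt (fun y => 4 * r ^ 2 * Real.log (1 + y / (2 * r)) - 2 * r * y)
          (4 * r ^ 2 * ((1 / (2 * r)) / (1 + y / (2 * r))) - 2 * r * 1) y :=
        ((((hasDerivAt_id y).div_const (2 * r)).const_add 1).log hp.ne' |>.const_mul _).sub
          ((hasDerivAt_id y).const_mul _)
      refine hd.congr_deriv ?_
      rw [logSlope, scaledDiffusion_mid hr hy1 hy2, min_eq_left hy2]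
      have hw : y = 2 * r * (1 + y / (2 * r) - 1) := by field_simp; ring
      generalize 1 + y / (2 * r) = w at hw hp
      rw [hw]
      field_simp
      ring
  have hp : 0 < 1 + x / (2 * r) := by linarith [one_add_div_pos hr h1]
  rw [dens, hint, scaledDiffusion_mid hr h1 h2, mul_comm 2, ← div_div, div_right_comm,
    div_self two_ne_zero]
  nth_rewrite 1 [← Real.exp_log hp]
  rw [one_div, ← Real.exp_neg, ← Real.exp_add]
  congr 1; ring

theorem dens_right {x : ℝ} (hr : 0 < r) (hz : 0 ≤ z) (h : z ≤ x) :
    dens r z x = dens r z z * Real.exp (-(2 * z / (2 + z / r)) * (x - z)) := by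
  have ha : ∀ y, z ≤ y → scaledDiffusion r z y = 2 + z / r := by
    intro y hy
    rw [scaledDiffusion, min_eq_right hy, max_eq_right (by positivity)]; ring
  have hint : ∫ y in z..x, logSlope r z y = -(2 * z / (2 + z / r)) * (x - z) := by
    rw [intervalIntegral.integral_congr (g := fun _ => -(2 * z / (2 + z / r)))]
    · rw [intervalIntegral.integral_const, smul_eq_mul, mul_comm]
    · intro y hy
      rw [uIcc_of_le h] at hy
      simp only [logSlope]
      rw [ha y hy.1, min_eq_right hy.1]; ring
  have hc := continuous_logSlope r z
  rw [dens, dens, ha x h, ha z le_rfl, ← intervalIntegral.integral_add_adjacent_intervals (b := z)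
    (hc.intervalIntegrable _ _) (hc.intervalIntegrable _ _), Real.exp_add, hint]
  ring

theorem dens_left {x : ℝ} (hr : 0 < r) (hz : 0 ≤ z) (h : x ≤ -r) :
    dens r z x = dens r z (-r) * Real.exp (r ^ 2 - x ^ 2) := by
  have ha : ∀ y, y ≤ -r → scaledDiffusion r z y = 1 := by
    intro y hy
    have : y / r ≤ -1 := by rw [div_le_iff₀ hr]; linarith
    rw [scaledDiffusion, min_eq_left (by linarith), max_eq_left (by linarith), add_zero]
  have hint : ∫ y in -r..x, logSlope r z y = r ^ 2 - x ^ 2 := by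
    rw [intervalIntegral.integral_congr (g := fun y => -2 * y)]
    · rw [intervalIntegral.integral_const_mul, integral_id]; ring
    · intro y hy
      rw [uIcc_of_ge h] at hy
      simp only [logSlope]
      rw [ha y hy.2, min_eq_left (by linarith [hy.2]), div_one]
  have hc := continuous_logSlope r z
  rw [dens, dens, ha x h, ha (-r) le_rfl,
    ← intervalIntegral.integral_add_adjacent_intervals (b := -r)
    (hc.intervalIntegrable 0 _) (hc.intervalIntegrable _ x), Real.exp_add, hint]
  ring

/-! ### Bounds on the density -/

/-- By log(1 + y) ≤ y the exponent is at most -x/(2r) ≤ 1/2, and e ≤ (5/3)². -/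
theorem dens_mid_le (hr : 1 ≤ r) (hz : 0 ≤ z) {x : ℝ} (h1 : -r ≤ x) (h2 : x ≤ z) :
    dens r z x ≤ 5 / 3 := by
  have hr0 : 0 < r := by linarith
  have hp := one_add_div_pos hr0 h1
  have hlog := Real.log_le_sub_one_of_pos (by linarith : 0 < 1 + x / (2 * r))
  have h3 : (4 * r ^ 2 - 1) * Real.log (1 + x / (2 * r)) ≤ (4 * r ^ 2 - 1) * (x / (2 * r)) :=
    mul_le_mul_of_nonneg_left (by linarith) (by nlinarith)
  have h4 : (4 * r ^ 2 - 1) * (x / (2 * r)) = 2 * r * x - x / (2 * r) := by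
    field_simp; ring
  rw [dens_mid hr0 hz h1 h2]
  calc Real.exp _ ≤ Real.exp (1 / 2) := Real.exp_le_exp.2 (by linarith)
    _ ≤ 5 / 3 := by
      refine le_of_pow_le_pow_left₀ (n := 2) (by norm_num) (by norm_num) ?_
      rw [← Real.exp_nat_mul]
      norm_num
      linarith [Real.exp_one_lt_d9]

theorem dens_le (hr : 1 ≤ r) (hz : 0 ≤ z) (x : ℝ) : dens r z x ≤ 5 / 3 := by
  have hr0 : 0 < r := by linarith
  rcases le_total x (-r) with h | h
  · rw [dens_left hr0 hz h]
    have h1 := dens_mid_le hr hz (x := -r) le_rfl (by linarith)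
    have h2 : Real.exp (r ^ 2 - x ^ 2) ≤ 1 := Real.exp_le_one_iff.2 (by nlinarith)
    nlinarith [dens_pos r z (-r), Real.exp_pos (r ^ 2 - x ^ 2)]
  rcases le_total x z with h' | h'
  · exact dens_mid_le hr hz h h'
  · rw [dens_right hr0 hz h']
    have h1 := dens_mid_le hr hz (x := z) (by linarith) le_rfl
    have h2 : Real.exp (-(2 * z / (2 + z / r)) * (x - z)) ≤ 1 :=
      Real.exp_le_one_iff.2 (by
        have : 0 ≤ 2 * z / (2 + z / r) := by positivity
        nlinarith)
    nlinarith [dens_pos r z z, Real.exp_pos (-(2 * z / (2 + z / r)) * (x - z))]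

/-- With s = √(1 + y), the inequality log s ≥ 1 - 1/s suffices: the difference of the two sides
contains the factor (s - 1)². -/
theorem le_log_one_add {y : ℝ} (h : -(1 / 2) ≤ y) : y - 3 / 2 * y ^ 2 ≤ Real.log (1 + y) := by
  have hs2 : √(1 + y) ^ 2 = 1 + y := Real.sq_sqrt (by linarith)
  have hlog : Real.log (1 + y) = 2 * Real.log √(1 + y) := by rw [← hs2, Real.log_pow, hs2]; norm_num
  have hs : 7 / 10 ≤ √(1 + y) := Real.le_sqrt_of_sq_le (by norm_num; linarith)
  set s := √(1 + y)
  have h1 := Real.one_sub_inv_le_log_of_pos (by linarith : 0 < s)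
  rw [hlog, show y = s ^ 2 - 1 by linarith]
  have hq : 0 ≤ 3 / 2 * s ^ 3 + 3 * s ^ 2 + s / 2 - 2 := by
    nlinarith [mul_nonneg (sub_nonneg.2 hs) (sub_nonneg.2 hs),
      pow_pos (by linarith : 0 < s) 3]
  have h2 : 2 * (1 - s⁻¹) - (s ^ 2 - 1 - 3 / 2 * (s ^ 2 - 1) ^ 2)
      = (s - 1) ^ 2 * (3 / 2 * s ^ 3 + 3 * s ^ 2 + s / 2 - 2) / s := by
    have : s ≠ 0 := by linarith
    field_simp; ring
  have h3 : 0 ≤ (s - 1) ^ 2 * (3 / 2 * s ^ 3 + 3 * s ^ 2 + s / 2 - 2) / s :=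
    div_nonneg (mul_nonneg (sq_nonneg _) hq) (by linarith)
  linarith

/-- With s = √(1 + y), log(1 + y) ≤ 2(s - 1) = y - (s - 1)², and (s - 1)² = y²/(s + 1)² with (s +
1)² ≤ 4(1 + |y|). -/
theorem log_one_add_le {y : ℝ} (h : -1 < y) :
    Real.log (1 + y) ≤ y - y ^ 2 / (4 * (1 + |y|)) := by
  have hs2 : √(1 + y) ^ 2 = 1 + y := Real.sq_sqrt (by linarith)
  have hlog : Real.log (1 + y) = 2 * Real.log √(1 + y) := by rw [← hs2, Real.log_pow, hs2]; norm_num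
  have hs : 0 < √(1 + y) := Real.sqrt_pos.2 (by linarith)
  set s := √(1 + y)
  have h1 := Real.log_le_sub_one_of_pos hs
  have h2 : y ^ 2 / (4 * (1 + |y|)) ≤ (s - 1) ^ 2 := by
    rw [div_le_iff₀ (by positivity), show y ^ 2 = (s - 1) ^ 2 * (s + 1) ^ 2 by
      rw [show y = s ^ 2 - 1 by linarith]; ring]
    refine mul_le_mul_of_nonneg_left ?_ (sq_nonneg _)
    nlinarith [sq_nonneg (s - 1), le_abs_self y, abs_nonneg y]
  rw [hlog]
  nlinarith

theorem le_dens_mid (hr : 1 ≤ r) (hz : 0 ≤ z) {x : ℝ} (h1 : -r ≤ x) (h2 : x ≤ z) :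
    1 - 3 / 2 * x ^ 2 - |x| / 2 ≤ dens r z x := by
  have hr0 : 0 < r := by linarith
  rw [dens_mid hr0 hz h1 h2]
  have hy : -(1 / 2) ≤ x / (2 * r) := by linarith [one_add_div_pos hr0 h1]
  have h3 := le_log_one_add hy
  have h4 := Real.log_le_sub_one_of_pos (by linarith : 0 < 1 + x / (2 * r))
  have h5 : 4 * r ^ 2 * (x / (2 * r) - 3 / 2 * (x / (2 * r)) ^ 2)
      = 2 * r * x - 3 / 2 * x ^ 2 := by
    field_simp; ring
  have h6 : 4 * r ^ 2 * (x / (2 * r) - 3 / 2 * (x / (2 * r)) ^ 2)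
      ≤ 4 * r ^ 2 * Real.log (1 + x / (2 * r)) := mul_le_mul_of_nonneg_left h3 (by positivity)
  have h7 := Real.add_one_le_exp ((4 * r ^ 2 - 1) * Real.log (1 + x / (2 * r)) - 2 * r * x)
  have h8 : x / (2 * r) ≤ |x| / 2 := by
    refine (div_le_div_of_nonneg_right (le_abs_self x) (by positivity)).trans ?_
    exact div_le_div_of_nonneg_left (abs_nonneg x) two_pos (by linarith)
  linarith

/-- For x ≤ 0 the prefactor 1/w is at least 1, so the loss |x|/2 of `le_dens_mid` disappears. The
bound then integrates to exactly 1/2 over [-1, 0]. -/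
theorem one_sub_sq_le_dens (hr : 1 ≤ r) (hz : 0 ≤ z) {x : ℝ} (h1 : -1 ≤ x) (h2 : x ≤ 0) :
    1 - 3 / 2 * x ^ 2 ≤ dens r z x := by
  have hr0 : 0 < r := by linarith
  rw [dens_mid hr0 hz (by linarith) (by linarith)]
  have hy : -(1 / 2) ≤ x / (2 * r) := by rw [le_div_iff₀ (by positivity)]; linarith
  have hy0 : x / (2 * r) ≤ 0 := div_nonpos_of_nonpos_of_nonneg h2 (by positivity)
  have h3 := le_log_one_add hy
  have h4 := Real.log_nonpos (by linarith : 0 ≤ 1 + x / (2 * r)) (by linarith)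
  have h5 : 4 * r ^ 2 * (x / (2 * r) - 3 / 2 * (x / (2 * r)) ^ 2)
      = 2 * r * x - 3 / 2 * x ^ 2 := by
    field_simp; ring
  have h6 : 4 * r ^ 2 * (x / (2 * r) - 3 / 2 * (x / (2 * r)) ^ 2)
      ≤ 4 * r ^ 2 * Real.log (1 + x / (2 * r)) := mul_le_mul_of_nonneg_left h3 (by positivity)
  have h7 := Real.add_one_le_exp ((4 * r ^ 2 - 1) * Real.log (1 + x / (2 * r)) - 2 * r * x)
  linarith

/-- The parabola r² - x² lies below its tangent 2r(x + r) at -r, which trades the Gaussian tail for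
an exponential one. -/
theorem dens_left_le (hr : 1 ≤ r) (hz : 0 ≤ z) {x : ℝ} (h : x ≤ -r) :
    dens r z x ≤ 2 * Real.exp (2 * r * r) * Real.exp (2 * r * x) := by
  have hr0 : 0 < r := by linarith
  rw [dens_left hr0 hz h, mul_assoc, ← Real.exp_add]
  refine mul_le_mul ((dens_le hr hz _).trans (by norm_num)) (Real.exp_le_exp.2 ?_)
    (Real.exp_pos _).le (by norm_num)
  nlinarith [sq_nonneg (x + r)]

theorem integrableOn_dens_left (hr : 1 ≤ r) (hz : 0 ≤ z) : IntegrableOn (dens r z) (Iic (-r)) := by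
  have hr0 : 0 < 2 * r := by linarith
  refine Integrable.mono' ((integrableOn_exp_mul_Iic hr0 (-r)).const_mul (2 * Real.exp (2 * r * r)))
    (continuous_dens r z).aestronglyMeasurable ?_
  refine (ae_restrict_iff' measurableSet_Iic).2 (Filter.Eventually.of_forall fun x hx => ?_)
  rw [Real.norm_eq_abs, abs_of_pos (dens_pos r z x)]
  exact dens_left_le hr hz hx

theorem integral_dens_left_le (hr : 1 ≤ r) (hz : 0 ≤ z) : ∫ x in Iic (-r), dens r z x ≤ 1 / r := by
  have hr0 : 0 < 2 * r := by linarith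
  calc ∫ x in Iic (-r), dens r z x
      ≤ ∫ x in Iic (-r), 2 * Real.exp (2 * r * r) * Real.exp (2 * r * x) :=
        setIntegral_mono_on (integrableOn_dens_left hr hz)
          ((integrableOn_exp_mul_Iic hr0 (-r)).const_mul _) measurableSet_Iic
          fun x hx => dens_left_le hr hz hx
    _ = 2 * (Real.exp (2 * r * r) * Real.exp (2 * r * -r)) / (2 * r) := by
        rw [integral_const_mul, integral_exp_mul_Iic hr0]; ring
    _ = 1 / r := by
        rw [← Real.exp_add, show 2 * r * r + 2 * r * -r = 0 by ring, Real.exp_zero]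
        field_simp

theorem integrableOn_dens_right (hr : 0 < r) (hz : 0 < z) :
    IntegrableOn (dens r z) (Ioi z) := by
  have hθ : -(2 * z / (2 + z / r)) < 0 := neg_lt_zero.2 (by positivity)
  refine IntegrableOn.congr_fun (((integrableOn_exp_mul_Ioi hθ z).const_mul
    (dens r z z * Real.exp (2 * z / (2 + z / r) * z)))) (fun x hx => ?_) measurableSet_Ioi
  rw [dens_right hr hz.le (le_of_lt hx), mul_assoc, ← Real.exp_add]
  congr 2; ring

theorem integral_dens_right (hr : 0 < r) (hz : 0 < z) :
    ∫ x in Ioi z, dens r z x = dens r z z / (2 * z / (2 + z / r)) := by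
  have hθ : -(2 * z / (2 + z / r)) < 0 := neg_lt_zero.2 (by positivity)
  rw [setIntegral_congr_fun (g := fun x => (dens r z z * Real.exp (2 * z / (2 + z / r) * z)) *
      Real.exp (-(2 * z / (2 + z / r)) * x)) measurableSet_Ioi, integral_const_mul,
    integral_exp_mul_Ioi hθ, neg_div_neg_eq, mul_div_assoc', mul_assoc, ← Real.exp_add]
  · rw [show 2 * z / (2 + z / r) * z + -(2 * z / (2 + z / r)) * z = 0 by ring, Real.exp_zero,
      mul_one]
  · intro x hx
    simp only
    rw [dens_right hr hz.le (le_of_lt hx), mul_assoc, ← Real.exp_add]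
    congr 2; ring

theorem integrable_dens (hr : 1 ≤ r) (hz : 0 < z) : Integrable (dens r z) := by
  rw [← integrableOn_univ, ← Iic_union_Ioi (a := z),
    ← Iic_union_Icc_eq_Iic (by linarith : -r ≤ z)]
  exact ((integrableOn_dens_left hr hz.le).union (continuous_dens r z).integrableOn_Icc).union
    (integrableOn_dens_right (by linarith) hz)

theorem le_integral_dens (hr : 1 ≤ r) (hz : 0 < z) : 1 / 2 ≤ ∫ x, dens r z x := by
  calc (1 / 2 : ℝ) = ∫ x in (-1 : ℝ)..0, (1 - 3 / 2 * x ^ 2) := by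
        rw [intervalIntegral.integral_sub (by simp)
          (Continuous.intervalIntegrable (by fun_prop) _ _), intervalIntegral.integral_const_mul]
        simp only [intervalIntegral.integral_const, integral_pow, smul_eq_mul]; norm_num
    _ ≤ ∫ x in (-1 : ℝ)..0, dens r z x :=
        intervalIntegral.integral_mono_on (by norm_num)
          (Continuous.intervalIntegrable (by fun_prop) _ _)
          ((continuous_dens r z).intervalIntegrable _ _)
          fun x hx => one_sub_sq_le_dens hr hz.le hx.1 hx.2
    _ ≤ ∫ x, dens r z x := by
        rw [intervalIntegral.integral_of_le (by norm_num)]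
        exact setIntegral_le_integral (integrable_dens hr hz)
          (Filter.Eventually.of_forall fun x => (dens_pos r z x).le)

theorem dens_div_le_integral (hr : 1 ≤ r) (hz : 0 < z) :
    dens r z z / (2 * z / (2 + z / r)) ≤ ∫ x, dens r z x := by
  rw [← integral_dens_right (by linarith) hz]
  exact setIntegral_le_integral (integrable_dens hr hz)
    (Filter.Eventually.of_forall fun x => (dens_pos r z x).le)

end dens

/-! ### The normalised density and the law of Y(∞) -/

theorem one_le_sqrt_load {lam mu : ℝ} (h : 1 ≤ load lam mu) : 1 ≤ √(load lam mu) :=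
  Real.one_le_sqrt.2 h

theorem zeta_neg {lam mu : ℝ} {n : ℕ} (h : 1 ≤ load lam mu) (hn : load lam mu < n) :
    0 < -zeta lam mu n := by
  unfold zeta
  rw [← neg_div]
  exact div_pos (by linarith) (by linarith [one_le_sqrt_load h])

theorem nu_bounds {lam mu : ℝ} {n : ℕ} (hmu : 0 < mu) (h : 1 ≤ load lam mu)
    (hn : load lam mu < n) (x : ℝ) : 0 ≤ nu lam mu n x ∧ nu lam mu n x ≤ 4 := by
  have hz := zeta_neg h hn
  have hr := one_le_sqrt_load h
  rw [nu_eq hmu (by linarith) (by linarith)]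
  have h1 := le_integral_dens hr hz
  have h2 := dens_le hr hz.le x
  have h3 := dens_pos (√(load lam mu)) (-zeta lam mu n) x
  have h4 : 0 < ∫ y, dens (√(load lam mu)) (-zeta lam mu n) y := by linarith
  refine ⟨by positivity, ?_⟩
  rw [inv_mul_le_iff₀ h4]; linarith

theorem integrable_nu {lam mu : ℝ} {n : ℕ} (hmu : 0 < mu) (h : 1 ≤ load lam mu)
    (hn : load lam mu < n) : Integrable (nu lam mu n) := by
  have hz := zeta_neg h hn
  rw [funext (nu_eq hmu (by linarith) (by linarith))]
  exact (integrable_dens (one_le_sqrt_load h) hz).const_mul _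

theorem lawY_real {lam mu : ℝ} {n : ℕ} (hmu : 0 < mu) (h : 1 ≤ load lam mu)
    (hn : load lam mu < n) {s : Set ℝ} (hs : MeasurableSet s) :
    (lawY lam mu n).real s = (∫ y, dens (√(load lam mu)) (-zeta lam mu n) y)⁻¹ *
      ∫ x in s, dens (√(load lam mu)) (-zeta lam mu n) x := by
  have hz := zeta_neg h hn
  rw [measureReal_def, lawY, withDensity_apply _ hs,
    ← ofReal_integral_eq_lintegral_ofReal (integrable_nu hmu h hn).integrableOn
      (Filter.Eventually.of_forall fun x => (nu_bounds hmu h hn x).1),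
    ENNReal.toReal_ofReal (integral_nonneg fun x => (nu_bounds hmu h hn x).1),
    funext (nu_eq hmu (by linarith) (by linarith)), integral_const_mul]

theorem isProbabilityMeasure_lawY {lam mu : ℝ} {n : ℕ} (hmu : 0 < mu) (h : 1 ≤ load lam mu)
    (hn : load lam mu < n) : IsProbabilityMeasure (lawY lam mu n) := by
  have hz := zeta_neg h hn
  refine ⟨?_⟩
  rw [lawY, withDensity_apply _ MeasurableSet.univ, Measure.restrict_univ,
    ← ofReal_integral_eq_lintegral_ofReal (integrable_nu hmu h hn)
      (Filter.Eventually.of_forall fun x => (nu_bounds hmu h hn x).1),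
    funext (nu_eq hmu (by linarith) (by linarith)), integral_const_mul, inv_mul_cancel₀,
    ENNReal.ofReal_one]
  linarith [le_integral_dens (one_le_sqrt_load h) hz]

/-! ### Detailed balance for the stationary distribution -/

theorem deriv_nonpos_of_le_initial {F : ℝ → ℝ} {F' : ℝ} (hF : HasDerivWithinAt F F' (Ici 0) 0)
    (h : ∀ t, 0 ≤ t → F t ≤ F 0) : F' ≤ 0 := by
  have h1 := hasDerivWithinAt_iff_tendsto_slope.1 hF
  rw [show Ici (0 : ℝ) \ {0} = Ioi 0 by ext; simp [lt_iff_le_and_ne, eq_comm]] at h1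
  refine le_of_tendsto h1 ?_
  filter_upwards [self_mem_nhdsWithin] with t ht
  rw [slope_def_field]
  exact div_nonpos_of_nonpos_of_nonneg (by linarith [h t (le_of_lt ht)])
    (by simpa using le_of_lt ht)

/-- A finite partial sum of the stationarity equation never exceeds ρ{j} and equals it at t = 0 when
j ∈ s, so its right derivative at 0 is nonpositive. Differentiation and infinite summation need not
be exchanged. -/
theorem IsStationary.sum_mul_le {q : ℕ → ℕ → ℝ} {ρ : Measure ℕ} (h : IsStationary q ρ)
    (s : Finset ℕ) {j : ℕ} (hj : j ∈ s) : ∑ i ∈ s, ρ.real {i} * q i j ≤ 0 := by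
  obtain ⟨-, p, hp, hρ⟩ := h
  have hd : HasDerivWithinAt (fun t => ∑ i ∈ s, ρ.real {i} * p t i j)
      (∑ i ∈ s, ρ.real {i} * q i j) (Ici 0) 0 :=
    HasDerivWithinAt.fun_sum fun i _ => (hp.generator i j).const_mul _
  refine deriv_nonpos_of_le_initial hd fun t ht => ?_
  have h0 : ∑ i ∈ s, ρ.real {i} * p 0 i j = ρ.real {j} := by
    simp_rw [hp.zero, mul_ite, mul_one, mul_zero]
    rw [Finset.sum_ite_eq' s j]; simp [hj]
  rw [h0]
  exact sum_le_hasSum s (fun i _ => mul_nonneg measureReal_nonneg (hp.nonneg t ht i j)) (hρ t ht j)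

theorem hasSum_real_singleton (ρ : Measure ℕ) [IsProbabilityMeasure ρ] :
    HasSum (fun k => ρ.real {k}) 1 := by
  have h : ∑' k, ρ {k} = 1 := by
    have := ρ.tsum_indicator_apply_singleton univ MeasurableSet.univ
    rwa [indicator_univ, measure_univ] at this
  have h2 := ENNReal.hasSum_toReal (f := fun k => ρ {k}) (by rw [h]; exact ENNReal.one_ne_top)
  rwa [← ENNReal.tsum_toReal_eq (fun k => measure_ne_top ρ {k}), h, ENNReal.toReal_one] at h2

/-- The inequalities from `IsStationary.sum_mul_le` suffice: they say that the net flow J is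
nonnegative at 0 and nondecreasing. It tends to 0 because the rates are bounded and ρ is summable,
hence it vanishes. -/
theorem IsStationary.balance {lam mu : ℝ} {n : ℕ} {ρ : Measure ℕ}
    (h : IsStationary (rate lam mu n) ρ) (k : ℕ) :
    mu * (min (k + 1) n : ℕ) * ρ.real {k + 1} = lam * ρ.real {k} := by
  have := h.1
  -- the net flow across the edge from `j` to `j + 1`
  set J : ℕ → ℝ := fun j => lam * ρ.real {j} - mu * (min (j + 1) n : ℕ) * ρ.real {j + 1} with hJ
  have h0 : 0 ≤ J 0 := by
    have e := h.sum_mul_le {0, 1} (j := 0) (by simp)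
    rw [Finset.sum_pair (by norm_num)] at e
    simp [rate] at e
    simp [hJ]; linarith
  have hmono : Monotone J := by
    refine monotone_nat_of_le_succ fun j => ?_
    have e := h.sum_mul_le {j, j + 1, j + 2} (j := j + 1) (by simp)
    rw [Finset.sum_insert (by simp), Finset.sum_pair (by simp)] at e
    simp [rate] at e
    simp only [hJ]
    push_cast
    rw [show j + 1 + 1 = j + 2 by ring, show (j : ℝ) + 1 + 1 = j + 2 by ring]
    linarith
  have hρ := (hasSum_real_singleton ρ).summable.tendsto_atTop_zero
  have hlim : Filter.Tendsto J Filter.atTop (nhds 0) := by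
    have h1 := hρ.const_mul lam
    have h2 := (hρ.comp (Filter.tendsto_add_atTop_nat 1)).const_mul (mu * n)
    rw [mul_zero] at h1 h2
    have h3 := h1.sub h2
    rw [sub_zero] at h3
    refine h3.congr' ?_
    filter_upwards [Filter.eventually_ge_atTop n] with j hj
    simp only [hJ, Function.comp]
    rw [min_eq_right (by omega)]
  have h1 : 0 ≤ J k := h0.trans (hmono (Nat.zero_le k))
  have h2 : J k ≤ 0 := hmono.ge_of_tendsto hlim k
  have h3 : J k = 0 := le_antisymm h2 h1
  simp only [hJ] at h3
  linarith

/-! ### Poisson weights near the mode -/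

/-- The logarithm of `R ^ k / k!`, normalised to vanish at `k = ⌊R⌋`. -/
noncomputable def logWeight (R : ℝ) (k : ℕ) : ℝ :=
  (k * Real.log R - Real.log k.factorial) - (⌊R⌋₊ * Real.log R - Real.log (⌊R⌋₊).factorial)

/-- The lattice point `(k - r²) / r`. -/
noncomputable def latt (r : ℝ) (k : ℕ) : ℝ := (k - r ^ 2) / r

section weights

variable {r : ℝ}

theorem logWeight_floor (R : ℝ) : logWeight R ⌊R⌋₊ = 0 := by simp [logWeight]

theorem logWeight_succ {R : ℝ} (hR : 0 < R) (k : ℕ) :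
    logWeight R (k + 1) = logWeight R k + Real.log (R / (k + 1)) := by
  have h1 : ((k : ℝ) + 1) ≠ 0 := by positivity
  have h2 : ((k.factorial : ℕ) : ℝ) ≠ 0 := by positivity
  rw [logWeight, logWeight, Nat.factorial_succ, Real.log_div hR.ne' h1]
  push_cast
  rw [Real.log_mul h1 h2]; ring

theorem latt_succ (hr : r ≠ 0) (k : ℕ) : latt r (k + 1) = latt r k + 1 / r := by
  unfold latt; push_cast; field_simp; ring

theorem latt_zero (hr : r ≠ 0) : latt r 0 = -r := by
  unfold latt; push_cast; field_simp; ring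

theorem cast_eq_latt (hr : r ≠ 0) (k : ℕ) : (k : ℝ) = r ^ 2 + r * latt r k := by
  unfold latt; field_simp; ring

theorem latt_nonpos (hr : 0 < r) {k : ℕ} (h : k ≤ ⌊r ^ 2⌋₊) : latt r k ≤ 0 := by
  have h1 : (k : ℝ) ≤ r ^ 2 := (Nat.cast_le.2 h).trans (Nat.floor_le (by positivity))
  exact div_nonpos_of_nonpos_of_nonneg (by linarith) hr.le

theorem latt_pos (hr : 0 < r) {k : ℕ} (h : ⌊r ^ 2⌋₊ < k) : 0 < latt r k :=
  div_pos (sub_pos.2 ((Nat.floor_lt (by positivity)).1 h)) hr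

theorem latt_floor (hr : 0 < r) : -(1 / r) ≤ latt r ⌊r ^ 2⌋₊ := by
  have := Nat.lt_floor_add_one (r ^ 2)
  rw [latt, neg_le_iff_add_nonneg, ← add_div]
  exact div_nonneg (by linarith) hr.le

/-- Induction away from the mode `⌊R⌋`, upwards and downwards. -/
theorem floor_induction {R : ℝ} {p : ℕ → Prop} (h0 : p ⌊R⌋₊)
    (hup : ∀ k, ⌊R⌋₊ ≤ k → p k → p (k + 1)) (hdown : ∀ k, k + 1 ≤ ⌊R⌋₊ → p (k + 1) → p k)
    (k : ℕ) : p k := by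
  rcases le_total k ⌊R⌋₊ with h | h
  · exact Nat.decreasingInduction (motive := fun m _ => p m) (fun m hm => hdown m hm) h0 h
  · exact Nat.le_induction (P := fun m _ => p m) h0 (fun m hm => hup m hm) k h

theorem logWeight_nonpos (hr : 0 < r) (k : ℕ) : logWeight (r ^ 2) k ≤ 0 := by
  have hR : 0 < r ^ 2 := by positivity
  refine floor_induction (R := r ^ 2) (p := fun k => logWeight (r ^ 2) k ≤ 0)
    (logWeight_floor _).le (fun k hk ih => ?_) (fun k hk ih => ?_) k
  · rw [logWeight_succ hR]
    have h1 : r ^ 2 < (k + 1 : ℕ) := (Nat.floor_lt hR.le).1 (by omega)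
    have : Real.log (r ^ 2 / (k + 1)) ≤ 0 :=
      Real.log_nonpos (by positivity) ((div_le_one (by positivity)).2 (by push_cast at h1; linarith))
    linarith
  · rw [logWeight_succ hR] at ih
    have h1 : ((k + 1 : ℕ) : ℝ) ≤ r ^ 2 := (Nat.cast_le.2 hk).trans (Nat.floor_le hR.le)
    have : 0 ≤ Real.log (r ^ 2 / (k + 1)) :=
      Real.log_nonneg ((one_le_div (by positivity)).2 (by push_cast at h1; linarith))
    linarith

/-- Up to distance 4 from the centre the right side is nonnegative and `logWeight_nonpos` suffices.
Farther out, each step of length 1/r away from the mode lowers the weight's logarithm by at least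
1/(2r). -/
theorem logWeight_le (hr : 1 ≤ r) (k : ℕ) : logWeight (r ^ 2) k ≤ 2 - |latt r k| / 2 := by
  have hr0 : 0 < r := by linarith
  have hR : 0 < r ^ 2 := by positivity
  have hinv : 1 / r ≤ 1 := by rw [div_le_one hr0]; exact hr
  have hinv0 : 0 < 1 / r := by positivity
  refine floor_induction (R := r ^ 2) (p := fun k => logWeight (r ^ 2) k ≤ 2 - |latt r k| / 2)
    ?_ (fun k hk ih => ?_) (fun k hk ih => ?_) k
  · rw [logWeight_floor, abs_of_nonpos (latt_nonpos hr0 le_rfl)]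
    linarith [latt_floor hr0]
  · have hs := latt_succ hr0.ne' k
    have hp := latt_pos hr0 (k := k + 1) (by omega)
    rcases le_total (latt r (k + 1)) 4 with h | h
    · rw [abs_of_pos hp]
      linarith [logWeight_nonpos hr0 (k + 1)]
    · have hk1 : ((k : ℝ) + 1) = r ^ 2 + r * latt r (k + 1) := by
        rw [← cast_eq_latt hr0.ne']; push_cast; ring
      have hpos : 0 < r ^ 2 / ((k : ℝ) + 1) := by positivity
      have h1 := Real.log_le_sub_one_of_pos hpos
      have h2 : r ^ 2 / ((k : ℝ) + 1) ≤ r / (r + 4) := by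
        rw [div_le_div_iff₀ (by positivity) (by positivity), hk1]
        nlinarith [mul_le_mul_of_nonneg_left h (mul_pos hr0 hr0).le]
      have h3 : r / (r + 4) - 1 ≤ -(1 / r / 2) := by
        have : r / (r + 4) - 1 = -(4 / (r + 4)) := by field_simp; ring
        rw [this, neg_le_neg_iff, div_div, div_le_div_iff₀ (by positivity) (by positivity)]
        linarith
      rw [abs_of_nonneg (by linarith : 0 ≤ latt r k)] at ih
      rw [logWeight_succ hR, abs_of_pos hp]
      linarith
  · have hs := latt_succ hr0.ne' k
    have hn := latt_nonpos hr0 (k := k) (by omega)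
    have hn1 := latt_nonpos hr0 hk
    rcases le_total (-4) (latt r k) with h | h
    · rw [abs_of_nonpos hn]
      linarith [logWeight_nonpos hr0 k]
    · have hk1 : ((k : ℝ) + 1) = r ^ 2 + r * latt r (k + 1) := by
        rw [← cast_eq_latt hr0.ne']; push_cast; ring
      have hpos : 0 < ((k : ℝ) + 1) / r ^ 2 := by positivity
      have h1 := Real.log_le_sub_one_of_pos hpos
      have h2 : ((k : ℝ) + 1) / r ^ 2 = 1 + latt r (k + 1) * (1 / r) := by
        rw [hk1]; field_simp
      have h3 : latt r (k + 1) * (1 / r) ≤ (-3) * (1 / r) :=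
        mul_le_mul_of_nonneg_right (by linarith) hinv0.le
      rw [logWeight_succ hR, ← inv_div, Real.log_inv, abs_of_nonpos hn1] at ih
      rw [abs_of_nonpos hn]
      linarith

/-- With t = (j + 1)/r² = 1 + x/r, the weight's increment is -log t and that of x²/2 is t - 1 -
1/(2r²). They cancel to second order, with t ≥ 1/2 controlling the remainder. -/
theorem abs_log_increment_le (hr : 0 < r) {j : ℕ} (hj : r ^ 2 / 2 ≤ ((j + 1 : ℕ) : ℝ)) :
    |Real.log (r ^ 2 / (j + 1)) + (latt r (j + 1) ^ 2 - latt r j ^ 2) / 2|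
      ≤ (2 * latt r (j + 1) ^ 2 + 1 / 2) / r ^ 2 := by
  have hR : 0 < r ^ 2 := by positivity
  have hk1 : ((j : ℝ) + 1) = r ^ 2 + r * latt r (j + 1) := by
    rw [← cast_eq_latt hr.ne']; push_cast; ring
  have hs := latt_succ hr.ne' j
  set x := latt r (j + 1)
  set t := ((j : ℝ) + 1) / r ^ 2 with ht
  have ht0 : 0 < t := by positivity
  have ht2 : 1 / 2 ≤ t := by rw [ht, le_div_iff₀ hR]; push_cast at hj; linarith
  have htx : t - 1 = x / r := by rw [ht, hk1]; field_simp; ring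
  have h1 := Real.log_le_sub_one_of_pos ht0
  have h2 := Real.one_sub_inv_le_log_of_pos ht0
  have h3 : t - 1 - 2 * (t - 1) ^ 2 ≤ 1 - t⁻¹ := by
    have : 1 - t⁻¹ - (t - 1 - 2 * (t - 1) ^ 2) = (t - 1) ^ 2 * (2 * t - 1) / t := by
      field_simp; ring
    have h4 : 0 ≤ (t - 1) ^ 2 * (2 * t - 1) / t :=
      div_nonneg (mul_nonneg (sq_nonneg _) (by linarith)) ht0.le
    linarith
  have h5 : (x ^ 2 - latt r j ^ 2) / 2 = (t - 1) - 1 / (2 * r ^ 2) := by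
    rw [htx, show latt r j = x - 1 / r by linarith]; field_simp; ring
  have h6 : (2 * x ^ 2 + 1 / 2) / r ^ 2 = 2 * (t - 1) ^ 2 + 1 / (2 * r ^ 2) := by
    rw [htx]; field_simp
  have h7 : 0 < 1 / (2 * r ^ 2) := by positivity
  rw [h5, h6, ← inv_div, Real.log_inv, ← ht, abs_le]
  constructor <;> nlinarith [sq_nonneg (t - 1)]

/-- The one-step errors, O((1 + x²)/r²) each, accumulate over at most r(|x| + 1) steps from the
mode; the largest error on the path is at its far end. -/
theorem abs_logWeight_add_le (hr : 1 ≤ r) (k : ℕ) (hk : r ^ 2 / 2 ≤ ((k + 1 : ℕ) : ℝ)) :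
    |logWeight (r ^ 2) k + latt r k ^ 2 / 2|
      ≤ (1 / 2 + (|latt r k| + 1) * (2 * latt r k ^ 2 + 1 / 2)) / r := by
  have hr0 : 0 < r := by linarith
  have hR : 0 < r ^ 2 := by positivity
  have hinv0 : 0 < 1 / r := by positivity
  have key : ∀ k : ℕ, r ^ 2 / 2 ≤ ((k + 1 : ℕ) : ℝ) → |logWeight (r ^ 2) k + latt r k ^ 2 / 2|
      ≤ 1 / (2 * r ^ 2) + |(k : ℝ) - ⌊r ^ 2⌋₊| * ((2 * latt r k ^ 2 + 1 / 2) / r ^ 2) := by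
    refine floor_induction (R := r ^ 2) ?_ (fun k hk ih hk2 => ?_) (fun k hk ih hk2 => ?_)
    · intro _
      rw [logWeight_floor, sub_self, abs_zero, zero_mul, zero_add, add_zero,
        abs_of_nonneg (by positivity)]
      have h1 := latt_floor hr0
      have h2 := latt_nonpos hr0 (k := ⌊r ^ 2⌋₊) le_rfl
      have h3 : latt r ⌊r ^ 2⌋₊ ^ 2 ≤ (1 / r) ^ 2 := by
        rw [← neg_sq]; exact pow_le_pow_left₀ (by linarith) (by linarith) 2
      rw [one_div_pow] at h3
      rw [div_le_iff₀ two_pos]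
      calc _ ≤ 1 / r ^ 2 := h3
        _ = _ := by field_simp
    · have hfl := Nat.lt_floor_add_one (r ^ 2)
      have hkc : (⌊r ^ 2⌋₊ : ℝ) ≤ k := Nat.cast_le.2 hk
      have ih' := ih (by push_cast; linarith)
      have hinc := abs_log_increment_le hr0 (j := k) (by push_cast; linarith)
      have hs := latt_succ hr0.ne' k
      have hp := latt_pos hr0 (k := k + 1) (by omega)
      have hmul : |(k : ℝ) - ⌊r ^ 2⌋₊| * ((2 * latt r k ^ 2 + 1 / 2) / r ^ 2)
          ≤ |(k : ℝ) - ⌊r ^ 2⌋₊| * ((2 * latt r (k + 1) ^ 2 + 1 / 2) / r ^ 2) := by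
        rcases hk.eq_or_lt with h | h
        · rw [← h]; simp
        · have := latt_pos hr0 h
          gcongr; linarith
      have a1 : |(k : ℝ) - ⌊r ^ 2⌋₊| = k - ⌊r ^ 2⌋₊ := abs_of_nonneg (by linarith)
      have a2 : |((k + 1 : ℕ) : ℝ) - ⌊r ^ 2⌋₊| = k + 1 - ⌊r ^ 2⌋₊ := by
        push_cast; exact abs_of_nonneg (by linarith)
      rw [a1] at ih' hmul
      rw [logWeight_succ hR, show logWeight (r ^ 2) k + Real.log (r ^ 2 / (k + 1))
          + latt r (k + 1) ^ 2 / 2 = (logWeight (r ^ 2) k + latt r k ^ 2 / 2)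
          + (Real.log (r ^ 2 / (k + 1)) + (latt r (k + 1) ^ 2 - latt r k ^ 2) / 2) by ring, a2]
      refine (abs_add_le _ _).trans ?_
      linarith
    · have hkc : ((k + 1 : ℕ) : ℝ) ≤ ⌊r ^ 2⌋₊ := Nat.cast_le.2 hk
      have ih' := ih (by push_cast at hk2 ⊢; linarith)
      have hinc := abs_log_increment_le hr0 hk2
      have hs := latt_succ hr0.ne' k
      have hp := latt_nonpos hr0 hk
      have hsq : latt r (k + 1) ^ 2 ≤ latt r k ^ 2 := by
        rw [← neg_sq, ← neg_sq (latt r k)]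
        exact pow_le_pow_left₀ (by linarith) (by linarith) 2
      have hbd : (2 * latt r (k + 1) ^ 2 + 1 / 2) / r ^ 2 ≤ (2 * latt r k ^ 2 + 1 / 2) / r ^ 2 := by
        gcongr
      have hmul := mul_le_mul_of_nonneg_left hbd (abs_nonneg (((k + 1 : ℕ) : ℝ) - ⌊r ^ 2⌋₊))
      push_cast at hkc
      have a1 : |(k : ℝ) - ⌊r ^ 2⌋₊| = -(k - ⌊r ^ 2⌋₊) := abs_of_nonpos (by linarith)
      have a2 : |((k + 1 : ℕ) : ℝ) - ⌊r ^ 2⌋₊| = -(k + 1 - ⌊r ^ 2⌋₊) := by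
        push_cast; exact abs_of_nonpos (by linarith)
      rw [a2] at ih' hmul
      rw [show logWeight (r ^ 2) k + latt r k ^ 2 / 2
          = (logWeight (r ^ 2) (k + 1) + latt r (k + 1) ^ 2 / 2)
          - (Real.log (r ^ 2 / (k + 1)) + (latt r (k + 1) ^ 2 - latt r k ^ 2) / 2) by
          rw [logWeight_succ hR]; ring, a1]
      refine (abs_sub _ _).trans ?_
      linarith
  refine (key k hk).trans ?_
  have h1 : |(k : ℝ) - ⌊r ^ 2⌋₊| ≤ r * (|latt r k| + 1) := by
    have e := cast_eq_latt hr0.ne' k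
    have f1 := Nat.floor_le hR.le
    have f2 := Nat.lt_floor_add_one (r ^ 2)
    have g1 := mul_le_mul_of_nonneg_left (le_abs_self (latt r k)) hr0.le
    have g2 := mul_le_mul_of_nonneg_left (neg_abs_le (latt r k)) hr0.le
    rw [abs_le]; constructor <;> linarith
  have h2 : 1 / (2 * r ^ 2) ≤ 1 / 2 / r := by
    rw [div_div, one_div_le_one_div (by positivity) (by positivity)]; nlinarith
  calc _ ≤ 1 / 2 / r + r * (|latt r k| + 1) * ((2 * latt r k ^ 2 + 1 / 2) / r ^ 2) := by gcongr
    _ = _ := by field_simp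

end weights

/-! ### Pointwise comparison of Poisson weights and density -/

section comparison

variable {r z : ℝ}

/-- The logarithm of the density between `-r` and `z`. -/
noncomputable def logDens (r x : ℝ) : ℝ := (4 * r ^ 2 - 1) * Real.log (1 + x / (2 * r)) - 2 * r * x

theorem logDens_le (hr : 1 ≤ r) {x : ℝ} (hx : -r ≤ x) : logDens r x ≤ 2 - |x| / 2 := by
  have hr0 : 0 < r := by linarith
  have hp := one_add_div_pos hr0 hx
  have h1 := log_one_add_le (by linarith : -1 < x / (2 * r))
  have h3 : -1 ≤ Real.log (1 + x / (2 * r)) := by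
    have := Real.one_sub_inv_le_log_of_pos (by linarith : 0 < 1 + x / (2 * r))
    have h4 : (1 + x / (2 * r))⁻¹ ≤ (1 / 2)⁻¹ := inv_anti₀ (by norm_num) hp
    norm_num at h4 this ⊢
    linarith
  have h5 : 4 * r ^ 2 * (x / (2 * r) - (x / (2 * r)) ^ 2 / (4 * (1 + |x / (2 * r)|)))
      = 2 * r * x - x ^ 2 / (4 * (1 + |x / (2 * r)|)) := by
    field_simp; ring
  have h6 : (|x| - 2) / 2 ≤ x ^ 2 / (4 * (1 + |x / (2 * r)|)) := by
    have h7 : |x / (2 * r)| ≤ |x| / 2 := by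
      rw [abs_div, abs_of_pos (by linarith : 0 < 2 * r)]
      exact div_le_div_of_nonneg_left (abs_nonneg x) two_pos (by linarith)
    calc (|x| - 2) / 2 ≤ x ^ 2 / (4 * (1 + |x| / 2)) := by
          rw [le_div_iff₀ (by positivity), ← sq_abs x]; nlinarith
      _ ≤ _ := by gcongr
  have h8 := mul_le_mul_of_nonneg_left h1 (by positivity : 0 ≤ 4 * r ^ 2)
  unfold logDens
  linarith

theorem abs_logDens_add_le (hr : 1 ≤ r) {x : ℝ} (hx : |x| ≤ r) :
    |logDens r x + x ^ 2 / 2| ≤ (|x| ^ 3 + |x|) / r := by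
  have hr0 : 0 < r := by linarith
  set y := x / (2 * r) with hy
  have hya : |y| = |x| / (2 * r) := by rw [hy, abs_div, abs_of_pos (by linarith : 0 < 2 * r)]
  have hy2 : |y| ≤ 1 / 2 := by rw [hya, div_le_iff₀ (by linarith)]; linarith
  have hyb := abs_le.1 hy2
  have h1 := Real.abs_log_sub_add_sum_range_le (x := -y) (by rw [abs_neg]; linarith) 2
  rw [abs_neg] at h1
  simp only [Finset.sum_range_succ, Finset.sum_range_zero] at h1
  norm_num at h1
  have h2 : |y| ^ 3 / (1 - |y|) ≤ 2 * |y| ^ 3 := by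
    rw [div_le_iff₀ (by linarith)]
    nlinarith [pow_nonneg (abs_nonneg y) 3]
  have h3 : |Real.log (1 + y)| ≤ 2 * |y| := by
    have a1 := Real.log_le_sub_one_of_pos (by linarith : 0 < 1 + y)
    have a2 := le_log_one_add (by linarith : -(1 / 2) ≤ y)
    rw [abs_le]
    constructor <;> nlinarith [neg_abs_le y, le_abs_self y, sq_abs y, abs_nonneg y]
  have h4 : logDens r x + x ^ 2 / 2
      = 4 * r ^ 2 * (-y + y ^ 2 / 2 + Real.log (1 + y)) - Real.log (1 + y) := by
    have : x = 2 * r * y := by rw [hy]; field_simp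
    rw [logDens, ← hy, this]; ring
  rw [h4]
  refine (abs_sub _ _).trans ?_
  rw [abs_mul, abs_of_nonneg (by positivity : 0 ≤ 4 * r ^ 2)]
  calc _ ≤ 4 * r ^ 2 * (2 * |y| ^ 3) + 2 * |y| := by
        gcongr; exact h1.trans h2
    _ = (|x| ^ 3 + |x|) / r := by rw [hya]; field_simp; ring

theorem abs_exp_sub_exp_le {a b m : ℝ} (ha : a ≤ m) (hb : b ≤ m) :
    |Real.exp a - Real.exp b| ≤ |a - b| * Real.exp m := by
  have key : ∀ {a b : ℝ}, b ≤ a → a ≤ m → |Real.exp a - Real.exp b| ≤ |a - b| * Real.exp m := by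
    intro a b hab ha
    rw [abs_of_nonneg (sub_nonneg.2 (Real.exp_le_exp.2 hab)), abs_of_nonneg (sub_nonneg.2 hab)]
    have h1 := Real.add_one_le_exp (b - a)
    have h2 : Real.exp b = Real.exp a * Real.exp (b - a) := by rw [← Real.exp_add]; congr 1; ring
    have h3 := Real.exp_le_exp.2 ha
    have h4 := Real.exp_pos a
    rw [h2]
    nlinarith
  rcases le_total b a with h | h
  · exact key h ha
  · rw [abs_sub_comm, abs_sub_comm a]; exact key h hb

theorem cube_le_exp {A : ℝ} (hA : 0 ≤ A) : (1 + A) ^ 3 ≤ 6144 * Real.exp (A / 8) := by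
  have h := Real.pow_div_factorial_le_exp ((1 + A) / 8) (by positivity) 3
  have h2 : Real.exp ((1 + A) / 8) ≤ 2 * Real.exp (A / 8) := by
    rw [show (1 + A) / 8 = 1 / 8 + A / 8 by ring, Real.exp_add]
    gcongr
    have : Real.exp (1 / 8) ^ 8 ≤ 2 ^ 8 := by
      rw [← Real.exp_nat_mul]; norm_num; linarith [Real.exp_one_lt_d9]
    exact le_of_pow_le_pow_left₀ (by norm_num) (by norm_num) this
  norm_num [Nat.factorial] at h
  have e : ((1 + A) / 8) ^ 3 = (1 + A) ^ 3 / 512 := by ring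
  rw [e] at h
  linarith

theorem exp_three_le : Real.exp 3 ≤ 27 := by
  have h : Real.exp 3 = Real.exp 1 ^ 3 := by rw [← Real.exp_nat_mul]; norm_num
  rw [h]
  calc Real.exp 1 ^ 3 ≤ 3 ^ 3 :=
        pow_le_pow_left₀ (Real.exp_pos 1).le (by linarith [Real.exp_one_lt_d9]) 3
    _ = 27 := by norm_num

/-- Local comparison of the Poisson weights with the density. -/
theorem abs_exp_logWeight_sub_dens_le (hr : 1 ≤ r) (hz : 0 ≤ z) (k : ℕ) {x : ℝ}
    (h1 : latt r k ≤ x) (h2 : x ≤ latt r (k + 1)) (hxz : x ≤ z) :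
    |Real.exp (logWeight (r ^ 2) k) - dens r z x| ≤ 3000000 / r * Real.exp (-|x| / 4) := by
  have hr0 : 0 < r := by linarith
  have hinv0 : 0 < 1 / r := by positivity
  have hinv : 1 / r ≤ 1 := by rw [div_le_one hr0]; exact hr
  have hs := latt_succ hr0.ne' k
  have hxk : |x - latt r k| ≤ 1 / r := by rw [abs_le]; constructor <;> linarith
  have hxr : -r ≤ x := by
    refine le_trans ?_ h1
    rw [← latt_zero hr0.ne']
    unfold latt; gcongr; simp
  have hd : dens r z x = Real.exp (logDens r x) := dens_mid hr0 hz hxr hxz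
  have hA : |latt r k| ≤ |x| + 1 / r := by
    have := abs_sub_abs_le_abs_sub (latt r k) x
    rw [abs_sub_comm] at this; linarith
  have hA' : |x| ≤ |latt r k| + 1 / r := by
    have := abs_sub_abs_le_abs_sub x (latt r k); linarith
  have ha : logWeight (r ^ 2) k ≤ 3 - |x| / 2 := by linarith [logWeight_le hr k]
  have hb : logDens r x ≤ 3 - |x| / 2 := by linarith [logDens_le hr hxr]
  have hm : Real.exp (3 - |x| / 2) ≤ 27 * Real.exp (-|x| / 2) := by
    rw [sub_eq_add_neg, Real.exp_add, neg_div]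
    exact mul_le_mul_of_nonneg_right exp_three_le (Real.exp_pos _).le
  rw [hd]
  -- Far from the centre both terms are exponentially small, which absorbs the factor 1/r. Near it,
  -- the exponents differ by O((1 + |x|)³/r), and the cubic factor is absorbed by part of the decay
  -- exp(-|x|/2).
  rcases le_total (r / 2) |x| with h | h
  · have e1 : |Real.exp (logWeight (r ^ 2) k) - Real.exp (logDens r x)|
        ≤ 27 * Real.exp (-|x| / 2) := by
      have p1 := Real.exp_le_exp.2 ha
      have p2 := Real.exp_le_exp.2 hb
      rw [abs_le]
      constructor <;> linarith [Real.exp_pos (logWeight (r ^ 2) k), Real.exp_pos (logDens r x)]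
    have e2 : |x| / 4 ≤ Real.exp (|x| / 4) := by linarith [Real.add_one_le_exp (|x| / 4)]
    have e3 : Real.exp (-|x| / 4) = Real.exp (-|x| / 2) * Real.exp (|x| / 4) := by
      rw [← Real.exp_add]; congr 1; ring
    have e4 : 1 ≤ 8 / r * Real.exp (|x| / 4) := by
      rw [div_mul_eq_mul_div, le_div_iff₀ hr0]; linarith
    refine e1.trans ?_
    rw [e3]
    have e5 := mul_le_mul_of_nonneg_left e4 (Real.exp_pos (-|x| / 2)).le
    calc 27 * Real.exp (-|x| / 2)
        ≤ 27 * (Real.exp (-|x| / 2) * (8 / r * Real.exp (|x| / 4))) := by linarith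
      _ = 216 / r * (Real.exp (-|x| / 2) * Real.exp (|x| / 4)) := by ring
      _ ≤ _ := by gcongr; norm_num
  · have hk : r ^ 2 / 2 ≤ ((k + 1 : ℕ) : ℝ) := by
      rw [cast_eq_latt hr0.ne' (k + 1)]
      have := neg_abs_le x
      nlinarith
    have c1 := abs_logWeight_add_le hr k hk
    have c2 := abs_logDens_add_le hr (x := x) (by linarith)
    have c3 : |x ^ 2 / 2 - latt r k ^ 2 / 2| ≤ (|x| + 1 / 2) / r := by
      rw [show x ^ 2 / 2 - latt r k ^ 2 / 2 = (x - latt r k) * ((x + latt r k) / 2) by ring,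
        abs_mul]
      have : |(x + latt r k) / 2| ≤ |x| + 1 / 2 := by
        rw [abs_div, abs_two]
        have := abs_add_le x (latt r k)
        linarith
      calc _ ≤ 1 / r * (|x| + 1 / 2) := by gcongr
        _ = _ := by ring
    have c4 : |logWeight (r ^ 2) k - logDens r x| ≤ 13 * (1 + |x|) ^ 3 / r := by
      rw [show logWeight (r ^ 2) k - logDens r x = (logWeight (r ^ 2) k + latt r k ^ 2 / 2)
        - (logDens r x + x ^ 2 / 2) + (x ^ 2 / 2 - latt r k ^ 2 / 2) by ring]
      refine (abs_add_le _ _).trans ((add_le_add_left (abs_sub _ _) _).trans ?_)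
      have c5 : (1 / 2 + (|latt r k| + 1) * (2 * latt r k ^ 2 + 1 / 2)) / r
          ≤ (1 / 2 + (|x| + 1 + 1) * (2 * (|x| + 1) ^ 2 + 1 / 2)) / r := by
        rw [← sq_abs (latt r k)]
        have : |latt r k| ≤ |x| + 1 := by linarith
        gcongr
      calc _ ≤ (1 / 2 + (|x| + 1 + 1) * (2 * (|x| + 1) ^ 2 + 1 / 2)) / r + (|x| ^ 3 + |x|) / r
            + (|x| + 1 / 2) / r := by linarith
        _ = (1 / 2 + (|x| + 1 + 1) * (2 * (|x| + 1) ^ 2 + 1 / 2) + (|x| ^ 3 + |x|)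
            + (|x| + 1 / 2)) / r := by ring
        _ ≤ _ := by
          have := abs_nonneg x
          gcongr
          nlinarith [pow_nonneg this 2, pow_nonneg this 3]
    have c6 := cube_le_exp (abs_nonneg x)
    have e3 : Real.exp (|x| / 8) * Real.exp (-|x| / 2) ≤ Real.exp (-|x| / 4) := by
      rw [← Real.exp_add, Real.exp_le_exp]
      linarith [abs_nonneg x]
    calc _ ≤ |logWeight (r ^ 2) k - logDens r x| * Real.exp (3 - |x| / 2) :=
          abs_exp_sub_exp_le ha hb
      _ ≤ 13 * (6144 * Real.exp (|x| / 8)) / r * (27 * Real.exp (-|x| / 2)) := by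
          refine mul_le_mul (c4.trans ?_) hm (Real.exp_pos _).le (by positivity)
          gcongr
      _ = 13 * 6144 * 27 / r * (Real.exp (|x| / 8) * Real.exp (-|x| / 2)) := by ring
      _ ≤ 3000000 / r * Real.exp (-|x| / 4) := by gcongr; norm_num

end comparison

/-! ### Global comparison of the partial masses -/

/-- Stationary weights of the `M/M/n` queue with offered load `r²`, equal to the Poisson weights
normalised at the mode for `k ≤ n` and geometric beyond `n`. -/
noncomputable def queueWeight (r : ℝ) (n k : ℕ) : ℝ :=
  Real.exp (logWeight (r ^ 2) (min k n)) * (r ^ 2 / n) ^ (k - n)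

section tail

/-- The sum of powers of E = exp(-y) is an intermediary. Since 1/y ≤ 1/(1 - E) ≤ 1/y + 1, it exceeds
the exponential term by at most 1, and by `h2` it exceeds the sum of powers of ρ by at most 1. The
two errors have opposite signs. The bound is uniform as y tends to 0. -/
theorem geom_sub_exp_le {y ρ : ℝ} (hy : 0 < y) (h0 : 0 < ρ) (h1 : ρ ≤ Real.exp (-y))
    (h2 : 1 / y ≤ 1 / (1 - ρ)) (j : ℕ) :
    |∑ i ∈ Finset.range j, ρ ^ i - (1 - Real.exp (-y * j)) / y| ≤ 1 := by
  set E := Real.exp (-y) with hE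
  have hE0 : 0 < E := Real.exp_pos _
  have hE1 : E < 1 := by rw [hE, Real.exp_lt_one_iff]; linarith
  have hEj : Real.exp (-y * j) = E ^ j := by rw [hE, ← Real.exp_nat_mul]; congr 1; ring
  have hEj0 : 0 < E ^ j := by positivity
  have hEj1 : E ^ j ≤ 1 := pow_le_one₀ hE0.le hE1.le
  have hC : ∑ i ∈ Finset.range j, E ^ i = (1 - E ^ j) * (1 / (1 - E)) := by
    rw [geom_sum_eq hE1.ne, ← neg_sub 1 E, ← neg_sub 1 (E ^ j), neg_div_neg_eq]; ring
  have hlow : 1 / y ≤ 1 / (1 - E) :=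
    one_div_le_one_div_of_le (by linarith) (by linarith [Real.add_one_le_exp (-y)])
  have hupp : 1 / (1 - E) ≤ 1 / y + 1 := by
    have h3 := Real.add_one_le_exp y
    have h4 : E * Real.exp y = 1 := by rw [hE, ← Real.exp_add]; simp
    rw [div_le_iff₀ (by linarith), div_add_one hy.ne', div_mul_eq_mul_div, le_div_iff₀ hy]
    nlinarith
  have hsub : ∑ i ∈ Finset.range j, (E ^ i - ρ ^ i) ≤ 1 := by
    have s1 := hasSum_geometric_of_lt_one hE0.le hE1
    have s2 := hasSum_geometric_of_lt_one h0.le (h1.trans_lt hE1)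
    refine (sum_le_hasSum _ (fun i _ => sub_nonneg.2 (pow_le_pow_left₀ h0.le h1 i))
      (s1.sub s2)).trans ?_
    rw [← one_div, ← one_div]; linarith
  have hpos : 0 ≤ ∑ i ∈ Finset.range j, (E ^ i - ρ ^ i) :=
    Finset.sum_nonneg fun i _ => sub_nonneg.2 (pow_le_pow_left₀ h0.le h1 i)
  rw [Finset.sum_sub_distrib, hC] at hsub hpos
  rw [hEj, show (1 - E ^ j) / y = (1 - E ^ j) * (1 / y) by ring, abs_le]
  constructor <;> nlinarith

theorem two_mul_div_le_log {R n : ℝ} (hR : 0 < R) (hn : R < n) :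
    2 * (n - R) / (n + R) ≤ Real.log (n / R) := by
  have h := Real.le_log_one_add_of_nonneg (x := (n - R) / R) (div_nonneg (by linarith) hR.le)
  rw [show 1 + (n - R) / R = n / R by field_simp; ring] at h
  refine le_trans (le_of_eq ?_) h
  rw [show (n - R) / R + 2 = (n + R) / R by field_simp; ring, mul_div_assoc',
    div_div_div_cancel_right₀ hR.ne']

end tail

theorem integrable_exp_neg_abs_div : Integrable fun x : ℝ => Real.exp (-|x| / 4) := by
  by_contra h
  -- This identity needs no integrability; without integrability its left side would be 0 by
  -- convention, whereas the right side is positive.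
  have h1 := integral_comp_abs (f := fun u => Real.exp (-u / 4))
  rw [integral_undef h] at h1
  have h2 := integral_exp_mul_Ioi (a := -(1 / 4)) (by norm_num) 0
  rw [show (fun x : ℝ => Real.exp (-(1 / 4) * x)) = fun u => Real.exp (-u / 4) by
    funext x; congr 1; ring] at h2
  rw [h2] at h1
  norm_num at h1

theorem integral_exp_neg_abs_div : ∫ x : ℝ, Real.exp (-|x| / 4) = 8 := by
  have h1 := integral_comp_abs (f := fun u => Real.exp (-u / 4))
  have h2 := integral_exp_mul_Ioi (a := -(1 / 4)) (by norm_num) 0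
  rw [show (fun x : ℝ => Real.exp (-(1 / 4) * x)) = fun u => Real.exp (-u / 4) by
    funext x; congr 1; ring] at h2
  rw [h1, h2]; norm_num

section partial_sums

variable {r : ℝ} {n : ℕ}

theorem latt_mono (hr : 0 < r) : Monotone (latt r) := fun a b h => by
  unfold latt; gcongr

theorem queueWeight_of_le {k : ℕ} (h : k ≤ n) :
    queueWeight r n k = Real.exp (logWeight (r ^ 2) k) := by
  rw [queueWeight, min_eq_left h, Nat.sub_eq_zero_of_le h, pow_zero, mul_one]

theorem queueWeight_add (j : ℕ) :
    queueWeight r n (n + j) = Real.exp (logWeight (r ^ 2) n) * (r ^ 2 / n) ^ j := by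
  rw [queueWeight, min_eq_right (Nat.le_add_right n j), Nat.add_sub_cancel_left]

theorem integral_Iic_latt (hr : 1 ≤ r) (hz : 0 < latt r n) (N : ℕ) :
    ∫ x in Iic (latt r N), dens r (latt r n) x = (∫ x in Iic (-r), dens r (latt r n) x)
      + ∫ x in (-r)..(latt r N), dens r (latt r n) x := by
  have hr0 : 0 < r := by linarith
  have h := intervalIntegral.integral_Iic_sub_Iic
    (integrable_dens hr hz).integrableOn (integrable_dens hr hz).integrableOn
    (a := -r) (b := latt r N)
  linarith

theorem abs_sum_sub_integral_le_of_le (hr : 1 ≤ r) (hz : 0 < latt r n) {N : ℕ} (hN : N ≤ n) :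
    |1 / r * ∑ k ∈ Finset.range N, queueWeight r n k
      - ∫ x in (-r)..(latt r N), dens r (latt r n) x| ≤ 24000000 / r := by
  have hr0 : 0 < r := by linarith
  set f := dens r (latt r n) with hf
  have hfc : Continuous f := continuous_dens _ _
  have hg : Continuous fun x : ℝ => 3000000 / r * Real.exp (-|x| / 4) := by fun_prop
  rw [← latt_zero hr0.ne', ← intervalIntegral.sum_integral_adjacent_intervals
    (fun k _ => hfc.intervalIntegrable _ _), Finset.mul_sum, ← Finset.sum_sub_distrib]
  have hcell : ∀ k ∈ Finset.range N, |1 / r * queueWeight r n k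
      - ∫ x in (latt r k)..(latt r (k + 1)), f x|
      ≤ ∫ x in (latt r k)..(latt r (k + 1)), 3000000 / r * Real.exp (-|x| / 4) := by
    intro k hk
    have hkn : k + 1 ≤ n := (Finset.mem_range.1 hk).trans_le hN
    have hle : latt r k ≤ latt r (k + 1) := latt_mono hr0 k.le_succ
    have e : 1 / r * queueWeight r n k
        = ∫ x in (latt r k)..(latt r (k + 1)), queueWeight r n k := by
      rw [intervalIntegral.integral_const, latt_succ hr0.ne', smul_eq_mul]; ring
    rw [e, ← intervalIntegral.integral_sub (by simp) (hfc.intervalIntegrable _ _)]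
    refine (intervalIntegral.abs_integral_le_integral_abs hle).trans ?_
    refine intervalIntegral.integral_mono_on hle
      ((continuous_const.sub hfc).abs.intervalIntegrable _ _) (hg.intervalIntegrable _ _) ?_
    intro x hx
    rw [queueWeight_of_le (by omega)]
    exact abs_exp_logWeight_sub_dens_le hr hz.le k hx.1 hx.2 (hx.2.trans (latt_mono hr0 hkn))
  refine (Finset.abs_sum_le_sum_abs _ _).trans ((Finset.sum_le_sum hcell).trans ?_)
  rw [intervalIntegral.sum_integral_adjacent_intervals (fun k _ => hg.intervalIntegrable _ _),
    intervalIntegral.integral_of_le (latt_mono hr0 (Nat.zero_le N)), integral_const_mul]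
  calc _ ≤ 3000000 / r * ∫ x : ℝ, Real.exp (-|x| / 4) := by
        refine mul_le_mul_of_nonneg_left ?_ (by positivity)
        exact setIntegral_le_integral integrable_exp_neg_abs_div
          (Filter.Eventually.of_forall fun x => (Real.exp_pos _).le)
    _ = 24000000 / r := by rw [integral_exp_neg_abs_div]; ring

/-- The tail amplifies the error at z by 1/θ, with θ = 2z/(2 + z/r) its exponential rate, and 1/θ is
unbounded as z tends to 0. But the tail's mass is the density at z divided by θ, and that density is
at least 3/8 for z ≤ 1/2, so 1/θ ≤ 5V. -/
theorem abs_weight_sub_dens_div_le (hr : 1 ≤ r) (hz : 0 < latt r n) :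
    |Real.exp (logWeight (r ^ 2) n) - dens r (latt r n) (latt r n)|
      / (2 * latt r n / (2 + latt r n / r))
      ≤ 15000000 / r * ∫ x, dens r (latt r n) x := by
  have hr0 : 0 < r := by linarith
  have h1 := abs_exp_logWeight_sub_dens_le hr hz.le n le_rfl (latt_mono hr0 n.le_succ) le_rfl
  have hV := le_integral_dens hr hz
  have hV2 := dens_div_le_integral hr hz
  set z := latt r n
  set V := ∫ x, dens r z x
  have h2 : Real.exp (-|z| / 4) ≤ 1 :=
    Real.exp_le_one_iff.2 (by linarith [abs_nonneg z])
  have h3 : |Real.exp (logWeight (r ^ 2) n) - dens r z z| ≤ 3000000 / r :=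
    h1.trans (mul_le_of_le_one_right (by positivity) h2)
  have hθ : 0 < 2 * z / (2 + z / r) := by positivity
  have h4 : 1 / (2 * z / (2 + z / r)) ≤ 5 * V := by
    rcases le_total z (1 / 2) with h | h
    · have h5 := le_dens_mid hr hz.le (x := z) (by linarith) le_rfl
      rw [abs_of_pos hz] at h5
      have h6 : 3 / 8 ≤ dens r z z := by nlinarith
      have h7 : 3 / 8 / (2 * z / (2 + z / r)) ≤ V :=
        (div_le_div_of_nonneg_right h6 hθ.le).trans hV2
      have h8 : 1 / (2 * z / (2 + z / r)) = 8 / 3 * (3 / 8 / (2 * z / (2 + z / r))) := by ring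
      rw [h8]; linarith
    · have : 1 / (2 * z / (2 + z / r)) ≤ 5 / 2 := by
        rw [one_div_div, div_le_iff₀ (by positivity)]
        have : z / r ≤ z := div_le_self hz.le hr
        linarith
      linarith
  calc _ = |Real.exp (logWeight (r ^ 2) n) - dens r z z| * (1 / (2 * z / (2 + z / r))) := by ring
    _ ≤ 3000000 / r * (5 * V) := by gcongr
    _ = _ := by ring

theorem abs_tail_sum_sub_integral_le (hr : 1 ≤ r) (hz : 0 < latt r n) (j : ℕ) :
    |1 / r * ∑ i ∈ Finset.range j, queueWeight r n (n + i)
      - ∫ x in (latt r n)..(latt r (n + j)), dens r (latt r n) x|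
      ≤ 1 / r + 15000000 / r * ∫ x, dens r (latt r n) x := by
  have hr0 : 0 < r := by linarith
  have hD := abs_weight_sub_dens_div_le hr hz
  have hw1 : Real.exp (logWeight (r ^ 2) n) ≤ 1 :=
    Real.exp_le_one_iff.2 (logWeight_nonpos hr0 n)
  have hn : (n : ℝ) = r ^ 2 + r * latt r n := cast_eq_latt hr0.ne' n
  have hx : latt r (n + j) - latt r n = j / r := by unfold latt; push_cast; field_simp; ring
  simp_rw [queueWeight_add, ← Finset.mul_sum]
  have hle : latt r n ≤ latt r (n + j) := latt_mono hr0 (Nat.le_add_right _ _)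
  set V := ∫ x, dens r (latt r n) x
  set w := Real.exp (logWeight (r ^ 2) n)
  have hw0 : 0 < w := Real.exp_pos _
  set z := latt r n
  set θ := 2 * z / (2 + z / r) with hθ
  have hθ0 : 0 < θ := by positivity
  set y := θ / r with hy
  have hy0 : 0 < y := by positivity
  have hR : 0 < r ^ 2 := by positivity
  have hRn : r ^ 2 < n := by rw [hn]; nlinarith
  have hn0 : (0 : ℝ) < n := by linarith
  have hy2 : y = 2 * (n - r ^ 2) / (n + r ^ 2) := by
    rw [hy, hθ, hn]; field_simp; ring
  have hint : ∫ x in z..(latt r (n + j)), dens r z x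
      = dens r z z * ((1 - Real.exp (-y * j)) / y) / r := by
    have : ∫ x in z..(latt r (n + j)), dens r z x
        = ∫ x in z..(latt r (n + j)), dens r z z * Real.exp (-θ * (x - z)) := by
      refine intervalIntegral.integral_congr fun x hx => ?_
      rw [uIcc_of_le hle] at hx
      exact dens_right hr0 hz.le hx.1
    rw [this, intervalIntegral.integral_const_mul,
      intervalIntegral.integral_comp_sub_right (fun x => Real.exp (-θ * x)) z, sub_self, hx,
      intervalIntegral.integral_comp_mul_left (fun x => Real.exp x) (neg_ne_zero.2 hθ0.ne'),
      integral_exp, mul_zero, Real.exp_zero, smul_eq_mul, hy,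
      show -θ * (j / r) = -(θ / r) * j by ring]
    field_simp; ring
  -- Here y = 2(n - R)/(n + R): the first condition is log(n/R) ≥ y, the second is (n + R)/(2(n -
  -- R)) ≤ n/(n - R).
  have hgeo := geom_sub_exp_le (ρ := r ^ 2 / n) hy0 (by positivity)
    (by
      have := two_mul_div_le_log hR hRn
      rw [← hy2] at this
      rw [← Real.log_le_iff_le_exp (by positivity), ← inv_div, Real.log_inv]
      linarith)
    (by
      rw [hy2, one_div_div, one_sub_div hn0.ne', one_div_div]
      rw [div_le_div_iff₀ (by linarith) (by linarith)]
      nlinarith [mul_pos (sub_pos.2 hRn) (sub_pos.2 hRn)]) j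
  set S := ∑ i ∈ Finset.range j, (r ^ 2 / n) ^ i
  set A := (1 - Real.exp (-y * j)) / y
  have hA0 : 0 ≤ A := div_nonneg (sub_nonneg.2 (Real.exp_le_one_iff.2 (by
    have : 0 ≤ y * j := by positivity
    linarith))) hy0.le
  have hA1 : A ≤ 1 / y := div_le_div_of_nonneg_right (by linarith [Real.exp_pos (-y * j)]) hy0.le
  rw [hint]
  have e : 1 / r * (w * S) - dens r z z * A / r
      = 1 / r * (w * (S - A) + (w - dens r z z) * A) := by ring
  rw [e, abs_mul, abs_of_pos (by positivity : 0 < 1 / r)]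
  have hb : |w * (S - A) + (w - dens r z z) * A| ≤ 1 + |w - dens r z z| * (1 / y) := by
    refine (abs_add_le _ _).trans ?_
    rw [abs_mul, abs_mul, abs_of_pos hw0, abs_of_nonneg hA0]
    have := mul_le_mul hw1 hgeo (abs_nonneg _) zero_le_one
    have := mul_le_mul_of_nonneg_left hA1 (abs_nonneg (w - dens r z z))
    linarith
  calc _ ≤ 1 / r * (1 + |w - dens r z z| * (1 / y)) := by gcongr
    _ = 1 / r + |w - dens r z z| / θ := by rw [hy]; field_simp
    _ ≤ _ := by linarith

theorem abs_sum_sub_integral_le (hr : 1 ≤ r) (hz : 0 < latt r n) (N : ℕ) :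
    |1 / r * ∑ k ∈ Finset.range N, queueWeight r n k
      - ∫ x in Iic (latt r N), dens r (latt r n) x|
      ≤ 70000000 / r * ∫ x, dens r (latt r n) x := by
  have hr0 : 0 < r := by linarith
  have hinv : 0 < 1 / r := by positivity
  have hV := le_integral_dens hr hz
  have hl := integral_dens_left_le hr hz.le
  have hl0 : 0 ≤ ∫ x in Iic (-r), dens r (latt r n) x := integral_nonneg fun x => (dens_pos _ _ x).le
  rw [integral_Iic_latt hr hz]
  set V := ∫ x, dens r (latt r n) x
  have hVr : 1 / r ≤ 2 * (V / r) := by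
    rw [← mul_div_assoc]; exact div_le_div_of_nonneg_right (by linarith) hr0.le
  rw [show 70000000 / r * V = 70000000 * (V / r) by ring]
  rcases le_total N n with h | h
  · have h1 := abs_sum_sub_integral_le_of_le hr hz h
    rw [show 24000000 / r = 24000000 * (1 / r) by ring, abs_le] at h1
    rw [abs_le]
    constructor <;> linarith
  · obtain ⟨j, rfl⟩ := Nat.exists_eq_add_of_le h
    have h1 := abs_sum_sub_integral_le_of_le hr hz le_rfl
    have h2 := abs_tail_sum_sub_integral_le hr hz j
    have hi : ∀ a b, IntervalIntegrable (dens r (latt r n)) volume a b :=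
      fun a b => (continuous_dens _ _).intervalIntegrable a b
    rw [show 24000000 / r = 24000000 * (1 / r) by ring, abs_le] at h1
    rw [show 15000000 / r * (∫ x, dens r (latt r n) x) = 15000000 * (V / r) by
      simp only [V]; ring, abs_le] at h2
    rw [Finset.sum_range_add, ← intervalIntegral.integral_add_adjacent_intervals
      (hi (-r) (latt r n)) (hi _ _), mul_add, abs_le]
    constructor <;> linarith

end partial_sums

/-! ### Normalisation and the Kolmogorov bound -/

section final

variable {r : ℝ} {n : ℕ}

theorem queueWeight_pos (hr : 0 < r) (hn : 1 ≤ n) (k : ℕ) : 0 < queueWeight r n k := by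
  have : (0 : ℝ) < n := by exact_mod_cast hn
  unfold queueWeight; positivity

theorem queueWeight_succ (hr : 0 < r) (hn : 1 ≤ n) (k : ℕ) :
    (min (k + 1) n : ℕ) * queueWeight r n (k + 1) = r ^ 2 * queueWeight r n k := by
  have hn0 : (0 : ℝ) < n := by exact_mod_cast hn
  have hR : 0 < r ^ 2 := by positivity
  rcases Nat.lt_or_ge k n with h | h
  · rw [queueWeight_of_le h.le, queueWeight_of_le h, min_eq_left h, logWeight_succ hR,
      Real.exp_add, Real.exp_log (by positivity)]
    push_cast
    field_simp
  · obtain ⟨j, rfl⟩ := Nat.exists_eq_add_of_le h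
    rw [add_assoc, queueWeight_add, queueWeight_add, min_eq_right (by omega)]
    have e : (n : ℝ) * (r ^ 2 / n) = r ^ 2 := by field_simp
    rw [pow_succ (r ^ 2 / (n : ℝ)) j]
    linear_combination Real.exp (logWeight (r ^ 2) n) * (r ^ 2 / n) ^ j * e

/-- The stationary distribution is proportional to `queueWeight`. -/
theorem IsStationary.exists_eq_mul_queueWeight {lam mu : ℝ} {ρ : Measure ℕ} (hmu : 0 < mu)
    (hload : 0 < load lam mu) (hn : 1 ≤ n) (h : IsStationary (rate lam mu n) ρ) :
    ∃ c : ℝ, ∀ k, ρ.real {k} = c * queueWeight (√(load lam mu)) n k := by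
  have hr : 0 < √(load lam mu) := Real.sqrt_pos.2 hload
  have hq := queueWeight_pos hr hn
  refine ⟨ρ.real {0} / queueWeight (√(load lam mu)) n 0, fun k => ?_⟩
  induction k with
  | zero => rw [div_mul_cancel₀ _ (hq 0).ne']
  | succ k ih =>
    have h1 := h.balance k
    have h2 := queueWeight_succ hr hn k
    rw [Real.sq_sqrt hload.le] at h2
    have hm : (0 : ℝ) < (min (k + 1) n : ℕ) := by
      exact_mod_cast lt_min k.succ_pos hn
    have hl : lam = mu * load lam mu := by unfold load; field_simp
    rw [ih] at h1
    have h3 : mu * (min (k + 1) n : ℕ) * ρ.real {k + 1} = mu * (min (k + 1) n : ℕ) *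
        (ρ.real {0} / queueWeight (√(load lam mu)) n 0
          * queueWeight (√(load lam mu)) n (k + 1)) := by
      rw [h1]
      linear_combination
        -(mu * (ρ.real {0} / queueWeight (√(load lam mu)) n 0)) * h2
        + ρ.real {0} / queueWeight (√(load lam mu)) n 0 * queueWeight (√(load lam mu)) n k * hl
    exact mul_left_cancel₀ (by positivity) h3

theorem tendsto_integral_Iic_latt (hr : 1 ≤ r) (hz : 0 < latt r n) :
    Filter.Tendsto (fun N => ∫ x in Iic (latt r N), dens r (latt r n) x) Filter.atTop
      (nhds (∫ x, dens r (latt r n) x)) := by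
  have hr0 : 0 < r := by linarith
  refine (aecover_Iic ?_).integral_tendsto_of_countably_generated (integrable_dens hr hz)
  unfold latt
  exact Filter.Tendsto.atTop_div_const hr0
    (Filter.tendsto_atTop_add_const_right _ _ tendsto_natCast_atTop_atTop)

/-- Lattice points up to `a` form an initial segment, which ends within `1 / r` of `a`. -/
theorem exists_latt_le_iff (hr : 1 ≤ r) (hz : 0 < latt r n) (a : ℝ) :
    ∃ N : ℕ, (∀ k, latt r k ≤ a ↔ k < N) ∧
      |(∫ x in Iic (latt r N), dens r (latt r n) x) - ∫ x in Iic a, dens r (latt r n) x|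
        ≤ 2 / r := by
  have hr0 : 0 < r := by linarith
  have hiff : ∀ k : ℕ, latt r k ≤ a ↔ (k : ℝ) ≤ r ^ 2 + r * a := fun k => by
    rw [latt, div_le_iff₀ hr0]
    constructor <;> intro h <;> linarith
  have hi := integrable_dens hr hz
  have hpos : ∀ x, 0 ≤ dens r (latt r n) x := fun x => (dens_pos _ _ x).le
  rcases lt_or_ge (r ^ 2 + r * a) 0 with h | h
  · refine ⟨0, fun k => ?_, ?_⟩
    · rw [hiff]
      have : (0 : ℝ) ≤ k := k.cast_nonneg
      constructor
      · intro h'; linarith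
      · intro h'; omega
    · have ha : a ≤ -r := by nlinarith
      rw [latt_zero hr0.ne']
      have h1 := integral_dens_left_le hr hz.le
      have h2 : ∫ x in Iic a, dens r (latt r n) x ≤ ∫ x in Iic (-r), dens r (latt r n) x :=
        setIntegral_mono_set hi.integrableOn (Filter.Eventually.of_forall hpos)
          (Iic_subset_Iic.2 ha).eventuallyLE
      have h3 : 0 ≤ ∫ x in Iic a, dens r (latt r n) x := integral_nonneg hpos
      have h4 : 1 / r ≤ 2 / r := by gcongr; norm_num
      rw [abs_le]; constructor <;> linarith
  · refine ⟨⌊r ^ 2 + r * a⌋₊ + 1, fun k => ?_, ?_⟩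
    · rw [hiff, Nat.lt_succ_iff, Nat.le_floor_iff h]
    · have h1 : latt r ⌊r ^ 2 + r * a⌋₊ ≤ a := (hiff _).2 (Nat.floor_le h)
      have h2 : a ≤ latt r (⌊r ^ 2 + r * a⌋₊ + 1) := by
        refine (lt_of_not_ge fun h' => ?_).le
        have := (hiff _).1 h'
        push_cast at this
        linarith [Nat.lt_floor_add_one (r ^ 2 + r * a)]
      have hs := latt_succ hr0.ne' ⌊r ^ 2 + r * a⌋₊
      rw [intervalIntegral.integral_Iic_sub_Iic hi.integrableOn hi.integrableOn]
      have := intervalIntegral.norm_integral_le_of_norm_le_const (a := a)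
        (b := latt r (⌊r ^ 2 + r * a⌋₊ + 1)) (f := dens r (latt r n)) (C := 5 / 3)
        (fun x _ => by
          rw [Real.norm_eq_abs, abs_of_pos (dens_pos _ _ x)]; exact dens_le hr hz.le x)
      rw [Real.norm_eq_abs, abs_of_nonneg (sub_nonneg.2 h2)] at this
      have hinv : 0 < 1 / r := by positivity
      rw [show 2 / r = 2 * (1 / r) by ring]
      linarith

/-- Kolmogorov-type comparison of the normalised partial masses. -/
theorem abs_mul_sum_sub_le (hr : 1 ≤ r) (hn : 1 ≤ n) (hz : 0 < latt r n) {c : ℝ}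
    (hc : HasSum (fun k => c * queueWeight r n k) 1) (N : ℕ) :
    |∑ k ∈ Finset.range N, c * queueWeight r n k
      - (∫ x, dens r (latt r n) x)⁻¹ * ∫ x in Iic (latt r N), dens r (latt r n) x|
      ≤ 140000000 / r := by
  have hr0 : 0 < r := by linarith
  have hq := queueWeight_pos (n := n) hr0 hn
  have hD := abs_sum_sub_integral_le hr hz
  have hlim := tendsto_integral_Iic_latt hr hz
  have hV := le_integral_dens hr hz
  set V := ∫ x, dens r (latt r n) x
  have hV0 : 0 < V := by linarith
  have hc0 : 0 < c := by
    by_contra h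
    have := hc.nonpos fun k => mul_nonpos_of_nonpos_of_nonneg (not_lt.1 h) (hq k).le
    linarith
  have hS : ∀ N, 1 / r * ∑ k ∈ Finset.range N, queueWeight r n k
      = (1 / (r * c)) * ∑ k ∈ Finset.range N, c * queueWeight r n k := fun N => by
    rw [← Finset.mul_sum]; field_simp
  simp_rw [hS] at hD
  -- comparison of the total masses
  have hU : |1 / (r * c) - V| ≤ 70000000 / r * V := by
    have h1 := ((hc.tendsto_sum_nat.const_mul (1 / (r * c))).sub hlim).abs
    rw [mul_one] at h1
    exact le_of_tendsto h1 (Filter.Eventually.of_forall hD)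
  have hDN := hD N
  have hs1 : ∑ k ∈ Finset.range N, c * queueWeight r n k ≤ 1 :=
    sum_le_hasSum _ (fun k _ => mul_nonneg hc0.le (hq k).le) hc
  have hs0 : 0 ≤ ∑ k ∈ Finset.range N, c * queueWeight r n k :=
    Finset.sum_nonneg fun k _ => mul_nonneg hc0.le (hq k).le
  set s := ∑ k ∈ Finset.range N, c * queueWeight r n k
  set I := ∫ x in Iic (latt r N), dens r (latt r n) x
  have key : V * |s - V⁻¹ * I| ≤ V * (140000000 / r) := by
    nth_rewrite 1 [← abs_of_pos hV0]
    rw [← abs_mul, show V * (s - V⁻¹ * I) = (1 / (r * c) * s - I) - s * (1 / (r * c) - V) by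
      rw [mul_sub, mul_inv_cancel_left₀ hV0.ne']; ring]
    refine (abs_sub _ _).trans ?_
    rw [abs_mul, abs_of_nonneg hs0]
    have := mul_le_mul hs1 hU (abs_nonneg _) zero_le_one
    calc _ ≤ 70000000 / r * V + 1 * (70000000 / r * V) := add_le_add hDN this
      _ = _ := by ring
  exact le_of_mul_le_mul_left key hV0

theorem dK_map_scaled_lawY_le {lam mu : ℝ} (hn : 1 ≤ n) (hmu : 0 < mu) (hR : 1 ≤ load lam mu)
    (hRn : load lam mu < n) {ρ : Measure ℕ} (h : IsStationary (rate lam mu n) ρ) :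
    dK (ρ.map (scaled lam mu)) (lawY lam mu n)
      ≤ ENNReal.ofReal (200000000 * load lam mu ^ (-(1 / 3) : ℝ)) := by
  have := h.1
  have hr := one_le_sqrt_load hR
  have hr0 : 0 < √(load lam mu) := by linarith
  have hsq : √(load lam mu) ^ 2 = load lam mu := Real.sq_sqrt (by linarith)
  have hzeta := zeta_neg hR hRn
  have hlatt : -zeta lam mu n = latt √(load lam mu) n := by
    rw [zeta, latt, hsq]; ring
  have hz := hzeta
  rw [hlatt] at hz
  obtain ⟨c, hc⟩ := h.exists_eq_mul_queueWeight hmu (by linarith) hn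
  have hsum := hasSum_real_singleton ρ
  simp_rw [hc] at hsum
  refine dK_le fun a => ENNReal.ofReal_le_ofReal ?_
  obtain ⟨N, hN, hI⟩ := exists_latt_le_iff hr hz a
  have hmain := abs_mul_sum_sub_le hr hn hz hsum N
  have hρ : (ρ.map (scaled lam mu)).real (Iic a)
      = ∑ k ∈ Finset.range N, c * queueWeight (√(load lam mu)) n k := by
    rw [map_measureReal_apply (measurable_of_countable _) measurableSet_Iic]
    simp_rw [← hc]
    rw [sum_measureReal_singleton]
    congr 1
    ext k
    rw [mem_preimage, mem_Iic, Finset.mem_coe, Finset.mem_range, ← hN k, scaled, latt, hsq]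
  have hV := le_integral_dens hr hz
  rw [hρ, lawY_real hmu hR hRn measurableSet_Iic, hlatt]
  set r := √(load lam mu) with hrdef
  set V := ∫ x, dens r (latt r n) x
  set s := ∑ k ∈ Finset.range N, c * queueWeight r n k
  set I := ∫ x in Iic (latt r N), dens r (latt r n) x
  set I' := ∫ x in Iic a, dens r (latt r n) x
  have hinv : V⁻¹ ≤ 2 := by
    rw [inv_le_comm₀ (by linarith) two_pos]; linarith
  have h2 : |V⁻¹ * I - V⁻¹ * I'| ≤ 4 / r := by
    rw [← mul_sub, abs_mul, abs_of_pos (inv_pos.2 (by linarith : 0 < V))]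
    calc V⁻¹ * |I - I'| ≤ 2 * (2 / r) := by gcongr
      _ = _ := by ring
  have h3 : |s - V⁻¹ * I'| ≤ 200000000 / r := by
    refine (abs_sub_le s (V⁻¹ * I) _).trans ((add_le_add hmain h2).trans ?_)
    rw [← add_div]; gcongr; norm_num
  refine h3.trans ?_
  rw [div_eq_mul_inv]
  gcongr
  rw [hrdef, Real.sqrt_eq_rpow, ← Real.rpow_neg (by linarith)]
  -- The rate obtained is R^(-1/2), which R ≥ 1 weakens to R^(-1/3).
  exact Real.rpow_le_rpow_of_exponent_le hR (by norm_num)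

end final

end ErlangC

theorem mainTheorem3 :
    -- the `W₂` distance controls the Kolmogorov distance to a law with bounded density
    (∀ {Ω : Type*} [MeasurableSpace Ω] (P : Measure Ω) [IsProbabilityMeasure P]
        {Ω' : Type*} [MeasurableSpace Ω'] (P' : Measure Ω') [IsProbabilityMeasure P']
        (U : Ω → ℝ) (V : Ω' → ℝ) (C : ℝ),
        Measurable U → Measurable V → 0 < C →
        HasPDF V P' volume →
        (∀ᵐ x ∂volume, pdf V P' volume x ≤ ENNReal.ofReal C) →
        ErlangC.dW2 (P.map U) (P'.map V) < ENNReal.ofReal (4 * C) →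
        ErlangC.dK (P.map U) (P'.map V) ≤
          ENNReal.ofReal (5 * (C / 2) ^ (2 / 3 : ℝ)) *
            ErlangC.dW2 (P.map U) (P'.map V) ^ (1 / 3 : ℝ)) ∧
    -- `ν` is a probability density bounded by `4`
    (∀ (n : ℕ) (lam mu : ℝ), 1 ≤ n → 0 < lam → 0 < mu →
        1 ≤ ErlangC.load lam mu → ErlangC.load lam mu < n →
        IsProbabilityMeasure (ErlangC.lawY lam mu n) ∧
          ∀ x : ℝ, 0 ≤ ErlangC.nu lam mu n x ∧ ErlangC.nu lam mu n x ≤ 4) ∧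
    -- the Kolmogorov distance between the scaled customer count and `Y(∞)` is `O(R^{-1/3})`
    (∃ K : ℝ, 0 < K ∧
      ∀ (n : ℕ) (lam mu : ℝ), 1 ≤ n → 0 < lam → 0 < mu →
        1 ≤ ErlangC.load lam mu → ErlangC.load lam mu < n →
        ∀ {Ω : Type*} [MeasurableSpace Ω] (P : Measure Ω) [IsProbabilityMeasure P]
          {Ω' : Type*} [MeasurableSpace Ω'] (P' : Measure Ω') [IsProbabilityMeasure P']
          (X : Ω → ℕ) (Y : Ω' → ℝ),
          Measurable X → Measurable Y →
          ErlangC.IsStationary (ErlangC.rate lam mu n) (P.map X) →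
          P'.map Y = ErlangC.lawY lam mu n →
          ErlangC.dK (P.map (fun ω => ErlangC.scaled lam mu (X ω))) (P'.map Y) ≤
            ENNReal.ofReal (K * ErlangC.load lam mu ^ (-(1 / 3) : ℝ))) := by
  refine ⟨?_, ?_, 200000000, by norm_num, ?_⟩
  · intro Ω _ P _ Ω' _ P' _ U V C hU hV hC hpdf hbound hd
    have := Measure.isProbabilityMeasure_map (μ := P) hU.aemeasurable
    have := Measure.isProbabilityMeasure_map (μ := P') hV.aemeasurable
    exact ErlangC.dK_le_of_le_smul_volume hC (ErlangC.map_le_smul_volume hbound) hd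
  · intro n lam mu _ _ hmu hR hRn
    exact ⟨ErlangC.isProbabilityMeasure_lawY hmu hR hRn, ErlangC.nu_bounds hmu hR hRn⟩
  · intro n lam mu hn _ hmu hR hRn Ω _ P _ Ω' _ P' _ X Y hX _ hst hY
    have hmap : P.map (fun ω => ErlangC.scaled lam mu (X ω))
        = (P.map X).map (ErlangC.scaled lam mu) :=
      (Measure.map_map (g := ErlangC.scaled lam mu) (measurable_of_countable _) hX).symm
    rw [hmap, hY]
    exact ErlangC.dK_map_scaled_lawY_le hn hmu hR hRn hst
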